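/- Let $\mathcal X,\mathcal S,\mathcal Y,\mathcal Z$ be finite alphabets, $Q_S$ a distribution on $\mathcal S$, $W_{Y,Z|X,S}$ a discrete memoryless channel with i.i.d. state drawn from $Q_S$, legitimate receiver's output $Y$ and warden's output $Z$, and let $x_0\in\mathcal X$ be the innocent symbol. Put $Q_0(z)=\sum_{s}Q_S(s)W_{Z|X,S}(z|x_0,s)$ and assume $Q_0(z)>0$ for all $z\in\mathcal Z$. Logarithms are to base 2. A code of length $n$ with $|\mathcal M|$ messages and non-causal state information at the transmitter only consists of a (possibly randomized) encoder mapping a uniform message $M\in\mathcal M$, independent of $S^n$, and the whole state sequence $S^n$ to $X^n$, and a decoder mapping $Y^n$ to $\hat M\in\mathcal M$. A rate $R$ is an achievable covert rate if there is a sequence of codes, one for each length $n$, with $\frac1n\log|\mathcal M_n|\to R$, $\mathbb P(\hat M\neq M)\to0$ and $\mathbb D(P_{Z^n}\Vert Q_0^{\otimes n})\to0$. The covert capacity $C_{\mathrm{NC\text{-}T}}$ is the supremum of the achievable covert rates (this set is non-empty and bounded above). For a joint distribution of $(S,U,V,X,Y,Z)$ write $$\rho(P)=\min\{\mathbb I(U;Y)-\mathbb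 I(U;S),\ \mathbb I(U,V;Y)-\mathbb I(U;S|V)\}.$$ Let $\mathcal D$ be the set of all $P_{S,U,V,X,Y,Z}$, with finite alphabets $\mathcal U,\mathcal V$, such that - $P_{S,U,V,X,Y,Z}=Q_S\,P_{UV|S}\,\mathbf 1_{\{X=x(U,S)\}}\,W_{Y,Z|X,S}$ for some conditional distribution $P_{UV|S}$ and some function $x:\mathcal U\times\mathcal S\to\mathcal X$, - $P_Z=Q_0$, - $\rho(P)\ge \mathbb I(V;Z)-\mathbb I(V;S)$, - $\max\{|\mathcal U|,|\mathcal V|\}\le|\mathcal X||\mathcal S|+3$, and let $\mathcal R=\{R\ge0:\ R\le\rho(P)\text{ for some }P\in\mathcal D\}$. Then $\mathcal R$ has a maximum, and $$C_{\mathrm{NC\text{-}T}}\le\max\mathcal R .$$ -/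

import Mathlib

open Filter Topology

/-! ### Finite information measures (logarithms to base 2) -/

section InformationMeasures

open Classical in
/-- The probability mass function of the random variable `f` under the probability mass
function `P` on a finite sample space. -/
noncomputable def law {Ω A : Type*} [Fintype Ω] (P : Ω → ℝ) (f : Ω → A) (a : A) : ℝ :=
  ∑ ω, if f ω = a then P ω else 0

/-- Kullback–Leibler divergence `∑ P log₂ (P / Q)` of probability mass functions on a finite
alphabet. The summands with `P a = 0` vanish; the formula is used only where `P` is absolutely
continuous with respect to `Q`. -/
noncomputable def kl {A : Type*} [Fintype A] (P Q : A → ℝ) : ℝ :=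
  ∑ a, P a * Real.logb 2 (P a / Q a)

/-- Mutual information `I(f; g)` under `P`. -/
noncomputable def mutualInfo {Ω A B : Type*} [Fintype Ω] [Fintype A] [Fintype B]
    (P : Ω → ℝ) (f : Ω → A) (g : Ω → B) : ℝ :=
  kl (law P fun ω => (f ω, g ω)) fun p : A × B => law P f p.1 * law P g p.2

/-- Conditional mutual information `I(f; g | h)` under `P`. -/
noncomputable def condMutualInfo {Ω A B C : Type*} [Fintype Ω] [Fintype A] [Fintype B]
    [Fintype C] (P : Ω → ℝ) (f : Ω → A) (g : Ω → B) (h : Ω → C) : ℝ :=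
  ∑ a, ∑ b, ∑ c, law P (fun ω => (f ω, g ω, h ω)) (a, b, c) *
    Real.logb 2 (law P (fun ω => (f ω, g ω, h ω)) (a, b, c) * law P h c /
      (law P (fun ω => (f ω, h ω)) (a, c) * law P (fun ω => (g ω, h ω)) (b, c)))

end InformationMeasures

/-! ### The channel and its codes -/

/-- A discrete memoryless state-dependent channel with i.i.d. state and an innocent symbol. -/
structure StateChannel (X S Y Z : Type*) [Fintype S] [Fintype Y] [Fintype Z] where
  /-- the state distribution -/
  QS : S → ℝ
  QS_mem : QS ∈ stdSimplex ℝ S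
  /-- the transition law: `W x s (y, z)` is the probability of the outputs `(y, z)` -/
  W : X → S → Y × Z → ℝ
  W_mem : ∀ x s, W x s ∈ stdSimplex ℝ (Y × Z)
  /-- the innocent symbol -/
  x₀ : X

namespace StateChannel

variable {X S Y Z : Type*} [Fintype X] [Fintype S] [Fintype Y] [Fintype Z]

/-- The warden's output distribution induced by the innocent symbol. -/
noncomputable def Q₀ (ch : StateChannel X S Y Z) (z : Z) : ℝ :=
  ∑ s, ch.QS s * ∑ y, ch.W ch.x₀ s (y, z)

/-- A code of length `n` with `M` messages and non-causal state information at the encoder only.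
The encoder may randomize: `enc m s` is the distribution of the channel input sequence. -/
structure Code (X S Y : Type*) [Fintype X] (n M : ℕ) where
  enc : Fin M → (Fin n → S) → (Fin n → X) → ℝ
  enc_mem : ∀ m s, enc m s ∈ stdSimplex ℝ (Fin n → X)
  dec : (Fin n → Y) → Fin M

/-- The joint law of message, state, input and output sequences `(m, s, x, y, z)`, the message
being uniform and independent of the state. -/
noncomputable def codeJoint (ch : StateChannel X S Y Z) {n M : ℕ} (c : Code X S Y n M) :
    Fin M × (Fin n → S) × (Fin n → X) × (Fin n → Y) × (Fin n → Z) → ℝ :=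
  fun ⟨m, s, x, y, z⟩ =>
    (1 / (M : ℝ)) * (∏ i, ch.QS (s i)) * c.enc m s x * ∏ i, ch.W (x i) (s i) (y i, z i)

/-- The probability that the decoded message differs from the transmitted one. -/
noncomputable def errorProb (ch : StateChannel X S Y Z) {n M : ℕ} (c : Code X S Y n M) : ℝ :=
  ∑ ω, if c.dec ω.2.2.2.1 ≠ ω.1 then ch.codeJoint c ω else 0

/-- The law of the warden's output sequence. -/
noncomputable def wardenLaw (ch : StateChannel X S Y Z) {n M : ℕ} (c : Code X S Y n M) :
    (Fin n → Z) → ℝ :=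
  law (ch.codeJoint c) fun ω => ω.2.2.2.2

/-- `R` is an achievable covert rate: some sequence of codes, the `n`-th of length `n`, has rates
`log₂ (M n) / n → R`, error probability tending to `0`, and divergence between the warden's output
law and the `n`-fold product of `Q₀` tending to `0`. -/
def IsAchievable (ch : StateChannel X S Y Z) (R : ℝ) : Prop :=
  ∃ (M : ℕ → ℕ) (c : ∀ n, Code X S Y n (M n)),
    (∀ n, 0 < M n) ∧
    Tendsto (fun n : ℕ => Real.logb 2 (M n) / n) atTop (𝓝 R) ∧
    Tendsto (fun n => ch.errorProb (c n)) atTop (𝓝 0) ∧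
    Tendsto (fun n => kl (ch.wardenLaw (c n)) fun z => ∏ i, ch.Q₀ (z i)) atTop (𝓝 0)

/-- The covert capacity with non-causal state information at the transmitter only. -/
noncomputable def covertCapacity (ch : StateChannel X S Y Z) : ℝ :=
  sSup {R | ch.IsAchievable R}

/-! ### The single-letter region -/

open Classical in
/-- The joint law `Q_S P_{UV|S} 1{X = x(U,S)} W_{Y,Z|X,S}` of `(S, U, V, X, Y, Z)`. -/
noncomputable def auxJoint (ch : StateChannel X S Y Z) {U V : Type*}
    (PUV : S → U × V → ℝ) (x : U → S → X) : S × U × V × X × Y × Z → ℝ :=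
  fun ⟨s, u, v, a, y, z⟩ =>
    ch.QS s * PUV s (u, v) * (if a = x u s then 1 else 0) * ch.W a s (y, z)

/-- `min {I(U;Y) - I(U;S), I(U,V;Y) - I(U;S|V)}` for a joint law of `(S, U, V, X, Y, Z)`. -/
noncomputable def rateBound {U V : Type*} [Fintype U] [Fintype V]
    (P : S × U × V × X × Y × Z → ℝ) : ℝ :=
  min
    (mutualInfo P (fun ⟨_, u, _, _, _, _⟩ => u) (fun ⟨_, _, _, _, y, _⟩ => y)
      - mutualInfo P (fun ⟨_, u, _, _, _, _⟩ => u) (fun ⟨s, _, _, _, _, _⟩ => s))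
    (mutualInfo P (fun ⟨_, u, v, _, _, _⟩ => (u, v)) (fun ⟨_, _, _, _, y, _⟩ => y)
      - condMutualInfo P (fun ⟨_, u, _, _, _, _⟩ => u) (fun ⟨s, _, _, _, _, _⟩ => s)
          (fun ⟨_, _, v, _, _, _⟩ => v))

/-- The admissible joint laws of `(S, U, V, X, Y, Z)` with auxiliary alphabets `U` and `V`. -/
def admissible (ch : StateChannel X S Y Z) (U V : Type*) [Fintype U] [Fintype V] :
    Set (S × U × V × X × Y × Z → ℝ) :=
  {P | (∃ (PUV : S → U × V → ℝ) (x : U → S → X),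
          (∀ s, PUV s ∈ stdSimplex ℝ (U × V)) ∧ P = ch.auxJoint PUV x) ∧
       law P (fun ⟨_, _, _, _, _, z⟩ => z) = ch.Q₀ ∧
       mutualInfo P (fun ⟨_, _, v, _, _, _⟩ => v) (fun ⟨_, _, _, _, _, z⟩ => z)
         - mutualInfo P (fun ⟨_, _, v, _, _, _⟩ => v) (fun ⟨s, _, _, _, _, _⟩ => s)
         ≤ rateBound P}

/-- The set of nonnegative rates `R` bounded by `rateBound P` for an admissible `P` with auxiliary
alphabets of cardinality at most `|X||S| + 3`. -/
def outerRegion (ch : StateChannel X S Y Z) : Set ℝ :=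
  {R | 0 ≤ R ∧ ∃ k l : ℕ, max k l ≤ Fintype.card X * Fintype.card S + 3 ∧
    ∃ P ∈ ch.admissible (Fin k) (Fin l), R ≤ rateBound P}

end StateChannel

/-!
The bound is the Gelfand–Pinsker converse with the additional constraint that the warden's
single-letter output law equals `Q₀`.

*The region.* Taking the second auxiliary variable `V` constant makes both terms of `rateBound`
equal to `I(U;Y) - I(U;S)`, which is the first term for any `V`, and makes `I(V;Z) - I(V;S)`
vanish. As only nonnegative rates enter, the region is therefore
`{0 ≤ R ≤ I(U;Y) - I(U;S)}` over the laws with `P_S = Q_S` and `P_Z = Q₀`. Writing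
`I(U;Y) - I(U;S) = (H(Y) - H(S)) + (H(S|U) - H(Y|U))`, the functional depends only on the law of
`(S, X)` and on the number `H(S|U) - H(Y|U)`, and the pairs of these two form the convex hull of the
compact set `strategyGraph`: one point for every law of `S` and every function from states to
inputs (the input is a function of `U` and `S`). The hull is compact by Carathéodory's theorem, so
the objective, which is continuous, has a maximum on the `feasible` points; Carathéodory's theorem
also represents the maximizer by an auxiliary variable with `|X||S| + 2` values
(`isGreatest_outerRegion`). Randomized inputs stay in the hull, up to an increase of the second coordinate, because a stochastic kernel is a mixture of
functions and entropy is concave (`exists_mem_convexHull_of_nonneg`).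

*The converse.* For a code let `U_i = (M, Y_1, …, Y_{i-1}, S_{i+1}, …, S_n)`. Then
`H(U_i, S_i)` and `H(U_i, Y_i)` are consecutive terms of the sequence
`T_k = H(M, Y_1, …, Y_k, S_{k+1}, …, S_n)`, so `∑ (H(U_i, S_i) - H(U_i, Y_i))` telescopes to
`H(M, S^n) - H(M, Y^n) = H(M) + n H(S) - H(M, Y^n)` (`sum_ent_auxVar`). With Fano's inequality and
`H(Y^n) ≤ n H(Ȳ)`, where `Ȳ` has the average of the laws of the `Y_i`, this gives a point of the
hull whose objective is at least the rate up to a vanishing term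
(`exists_mem_convexHull_of_code`). Its warden law is the average of the laws of the `Z_i`, whose
divergence from `Q₀` is at most `1/n` times that of the law of `Z^n` from the product
(`mul_kl_avgLaw_le`). A limit point along the blocklength is feasible, since its divergence from `Q₀`
is zero, and its objective is at least the rate (`objective_ge_of_isAchievable`). Rate zero is
achievable by sending the innocent symbol, so the set of achievable rates is nonempty.
-/

/-! ### Laws and entropies of random variables on a finite space -/

/-- Shannon entropy in nats. It is used for arbitrary nonnegative vectors, not only for
probability mass functions. -/
noncomputable def ent {A : Type*} [Fintype A] (p : A → ℝ) : ℝ :=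
  ∑ a, Real.negMulLog (p a)

section Entropy

variable {Ω A B C : Type*} [Fintype Ω]

lemma law_nonneg {P : Ω → ℝ} (hP : ∀ ω, 0 ≤ P ω) (f : Ω → A) (a : A) : 0 ≤ law P f a :=
  Finset.sum_nonneg fun ω _ => by split_ifs <;> simp [hP ω]

lemma law_pos {P : Ω → ℝ} (hP : ∀ ω, 0 ≤ P ω) (f : Ω → A) {ω : Ω} (hω : P ω ≠ 0) :
    0 < law P f (f ω) := by
  refine lt_of_lt_of_le (lt_of_le_of_ne (hP ω) hω.symm) ?_
  classical
  have := Finset.single_le_sum (f := fun ω' => if f ω' = f ω then P ω' else 0)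
    (fun ω' _ => by split_ifs <;> simp [hP ω']) (Finset.mem_univ ω)
  simpa [law] using this

lemma law_congr_of_iff (P : Ω → ℝ) {f : Ω → A} {g : Ω → B} {a : A} {b : B}
    (h : ∀ ω, f ω = a ↔ g ω = b) : law P f a = law P g b := by
  classical
  simp only [law, h]

lemma sum_law_pair_right [Fintype B] (P : Ω → ℝ) (f : Ω → A) (g : Ω → B) (a : A) :
    ∑ b, law P (fun ω => (f ω, g ω)) (a, b) = law P f a := by
  classical
  simp only [law, Prod.mk.injEq]
  rw [Finset.sum_comm]
  refine Finset.sum_congr rfl fun ω _ => ?_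
  by_cases h : f ω = a <;> simp [h]

lemma law_eq_sum_mul [DecidableEq A] (P : Ω → ℝ) (f : Ω → A) (a : A) :
    law P f a = ∑ ω, P ω * if f ω = a then 1 else 0 := by
  exact Finset.sum_congr rfl fun ω _ => by by_cases h : f ω = a <;> simp [h]

lemma sum_law_pair_left [Fintype A] (P : Ω → ℝ) (f : Ω → A)
    (g : Ω → B) (b : B) : ∑ a, law P (fun ω => (f ω, g ω)) (a, b) = law P g b := by
  rw [← sum_law_pair_right P g f]
  exact Finset.sum_congr rfl fun a _ => law_congr_of_iff P fun ω => by simp [and_comm]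

lemma sum_law_pair_mul [DecidableEq A] [Fintype B] (P : Ω → ℝ) (f : Ω → A) (g : Ω → B) (a : A)
    (φ : B → ℝ) : ∑ b, law P (fun ω => (f ω, g ω)) (a, b) * φ b =
      ∑ ω, P ω * ((if f ω = a then 1 else 0) * φ (g ω)) := by
  classical
  simp only [law, Prod.mk.injEq, Finset.sum_mul]
  rw [Finset.sum_comm]
  refine Finset.sum_congr rfl fun ω _ => ?_
  by_cases h : f ω = a <;> simp [h]

variable [Fintype A] [Fintype B] [Fintype C]

lemma sum_law_mul (P : Ω → ℝ) (f : Ω → A) (φ : A → ℝ) :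
    ∑ a, law P f a * φ a = ∑ ω, P ω * φ (f ω) := by
  classical
  simp only [law, Finset.sum_mul]
  rw [Finset.sum_comm]
  refine Finset.sum_congr rfl fun ω _ => ?_
  simp [ite_mul]

lemma sum_law (P : Ω → ℝ) (f : Ω → A) : ∑ a, law P f a = ∑ ω, P ω := by
  simpa using sum_law_mul P f fun _ => 1

lemma ent_law (P : Ω → ℝ) (f : Ω → A) :
    ent (law P f) = -∑ ω, P ω * Real.log (law P f (f ω)) := by
  rw [← sum_law_mul P f fun a => Real.log (law P f a)]
  simp [ent, Real.negMulLog]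

/-- Random variables generating the same partition have the same entropy. -/
lemma ent_law_congr (P : Ω → ℝ) {f : Ω → A} {g : Ω → B}
    (h : ∀ ω ω', f ω = f ω' ↔ g ω = g ω') : ent (law P f) = ent (law P g) := by
  simp only [ent_law]
  congr 1
  refine Finset.sum_congr rfl fun ω _ => ?_
  rw [law_congr_of_iff P fun ω' => h ω' ω]

lemma mutualInfo_mul_log_two {P : Ω → ℝ} (hP : ∀ ω, 0 ≤ P ω) (f : Ω → A) (g : Ω → B) :
    mutualInfo P f g * Real.log 2 =
      ent (law P f) + ent (law P g) - ent (law P fun ω => (f ω, g ω)) := by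
  have h2 : Real.log 2 ≠ 0 := (Real.log_pos one_lt_two).ne'
  rw [mutualInfo, kl, sum_law_mul P (fun ω => (f ω, g ω))
    (fun q => Real.logb 2 (law P (fun ω => (f ω, g ω)) q / (law P f q.1 * law P g q.2))),
    ent_law, ent_law, ent_law, Finset.sum_mul, sub_neg_eq_add, ← neg_add,
    ← Finset.sum_add_distrib, neg_add_eq_sub, ← Finset.sum_sub_distrib]
  refine Finset.sum_congr rfl fun ω _ => ?_
  by_cases hω : P ω = 0
  · simp [hω]
  have h1 := (law_pos hP f hω).ne'
  have h3 := (law_pos hP g hω).ne'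
  have h4 := (law_pos hP (fun ω => (f ω, g ω)) hω).ne'
  rw [Real.logb, Real.log_div h4 (mul_ne_zero h1 h3), Real.log_mul h1 h3]
  field_simp

lemma condMutualInfo_mul_log_two {P : Ω → ℝ} (hP : ∀ ω, 0 ≤ P ω) (f : Ω → A) (g : Ω → B)
    (h : Ω → C) :
    condMutualInfo P f g h * Real.log 2 =
      ent (law P fun ω => (f ω, h ω)) + ent (law P fun ω => (g ω, h ω))
        - ent (law P fun ω => (f ω, g ω, h ω)) - ent (law P h) := by
  have h2 : Real.log 2 ≠ 0 := (Real.log_pos one_lt_two).ne'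
  have key := sum_law_mul P (fun ω => (f ω, g ω, h ω))
    (fun q => Real.logb 2 (law P (fun ω => (f ω, g ω, h ω)) q * law P h q.2.2 /
      (law P (fun ω => (f ω, h ω)) (q.1, q.2.2) * law P (fun ω => (g ω, h ω)) (q.2.1, q.2.2))))
  simp only [Fintype.sum_prod_type] at key
  rw [condMutualInfo, key, ent_law, ent_law, ent_law, ent_law, Finset.sum_mul, sub_neg_eq_add,
    sub_neg_eq_add, ← neg_add, ← Finset.sum_add_distrib, neg_add_eq_sub,
    ← Finset.sum_sub_distrib, ← Finset.sum_add_distrib]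
  refine Finset.sum_congr rfl fun ω _ => ?_
  by_cases hω : P ω = 0
  · simp [hω]
  have h1 := (law_pos hP h hω).ne'
  have h3 := (law_pos hP (fun ω => (f ω, h ω)) hω).ne'
  have h4 := (law_pos hP (fun ω => (g ω, h ω)) hω).ne'
  have h5 := (law_pos hP (fun ω => (f ω, g ω, h ω)) hω).ne'
  rw [Real.logb, Real.log_div (mul_ne_zero h5 h1) (mul_ne_zero h3 h4), Real.log_mul h5 h1,
    Real.log_mul h3 h4]
  field_simp
  ring

/-- A random variable with values in a subsingleton is independent of everything. -/
lemma mutualInfo_subsingleton_left [Subsingleton A] {P : Ω → ℝ} (hP : P ∈ stdSimplex ℝ Ω)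
    (f : Ω → A) (g : Ω → B) : mutualInfo P f g = 0 := by
  have h2 : Real.log 2 ≠ 0 := (Real.log_pos one_lt_two).ne'
  have h := mutualInfo_mul_log_two hP.1 f g
  have h1 : ent (law P fun ω => (f ω, g ω)) = ent (law P g) :=
    ent_law_congr P fun ω ω' => by simp [Subsingleton.elim (f ω) (f ω')]
  have h3 : ent (law P f) = 0 := by
    rw [ent_law]
    have : ∀ ω, law P f (f ω) = 1 := fun ω => by
      rw [← hP.2]
      exact Finset.sum_congr rfl fun ω' _ => by simp [Subsingleton.elim (f ω') (f ω)]
    simp [this]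
  rw [h1, h3] at h
  simpa [h2] using h

lemma mutualInfo_congr_left {P : Ω → ℝ} (hP : ∀ ω, 0 ≤ P ω) {f : Ω → A} {f' : Ω → C} (g : Ω → B)
    (h : ∀ ω ω', f ω = f ω' ↔ f' ω = f' ω') : mutualInfo P f g = mutualInfo P f' g := by
  have h2 : Real.log 2 ≠ 0 := (Real.log_pos one_lt_two).ne'
  refine mul_right_cancel₀ h2 ?_
  rw [mutualInfo_mul_log_two hP, mutualInfo_mul_log_two hP, ent_law_congr P h,
    ent_law_congr P (f := fun ω => (f ω, g ω)) (g := fun ω => (f' ω, g ω))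
      (by simp [Prod.ext_iff, h])]

lemma condMutualInfo_subsingleton [Subsingleton C] {P : Ω → ℝ} (hP : P ∈ stdSimplex ℝ Ω)
    (f : Ω → A) (g : Ω → B) (h : Ω → C) : condMutualInfo P f g h = mutualInfo P f g := by
  have h2 : Real.log 2 ≠ 0 := (Real.log_pos one_lt_two).ne'
  refine mul_right_cancel₀ h2 ?_
  have h0 := mutualInfo_mul_log_two hP.1 h h
  rw [mutualInfo_subsingleton_left hP, ent_law_congr P (f := fun ω => (h ω, h ω)) (g := h)
    (by simp)] at h0
  rw [condMutualInfo_mul_log_two hP.1, mutualInfo_mul_log_two hP.1,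
    ent_law_congr P (f := fun ω => (f ω, h ω)) (g := f) (by simp [eq_iff_true_of_subsingleton]),
    ent_law_congr P (f := fun ω => (g ω, h ω)) (g := g) (by simp [eq_iff_true_of_subsingleton]),
    ent_law_congr P (f := fun ω => (f ω, g ω, h ω)) (g := fun ω => (f ω, g ω))
      (by simp [eq_iff_true_of_subsingleton])]
  linarith

/-! ### Gibbs' inequality and its consequences -/

/-- Gibbs' inequality. -/
lemma sum_mul_log_le_neg_ent {p q : A → ℝ} (hp : ∀ a, 0 ≤ p a) (hq : ∀ a, 0 ≤ q a)
    (hpq : ∀ a, q a = 0 → p a = 0) (hs : ∑ a, q a ≤ ∑ a, p a) :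
    ∑ a, p a * Real.log (q a) ≤ -ent p := by
  have key : ∀ a, p a * Real.log (q a) + Real.negMulLog (p a) ≤ q a - p a := by
    intro a
    rcases (hp a).eq_or_lt with h | h
    · simp [← h, hq a]
    · have hq' : 0 < q a := lt_of_le_of_ne (hq a) fun h0 => h.ne' (hpq a h0.symm)
      have := Real.log_le_sub_one_of_pos (div_pos hq' h)
      rw [Real.log_div hq'.ne' h.ne'] at this
      have h3 := mul_le_mul_of_nonneg_left this h.le
      have h4 : p a * (q a / p a - 1) = q a - p a := by field_simp
      rw [h4] at h3
      simp only [Real.negMulLog]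
      linarith
  have := Finset.sum_le_sum fun a (_ : a ∈ Finset.univ) => key a
  rw [Finset.sum_add_distrib, Finset.sum_sub_distrib] at this
  change _ + ent p ≤ _ at this
  linarith

/-- The summands of the divergence with the linear terms, which cancel in the sum, subtracted. -/
lemma kl_mul_log_two {p q : A → ℝ} (hs : ∑ a, p a = ∑ a, q a) :
    kl p q * Real.log 2 = ∑ a, (p a * Real.log (p a / q a) - (p a - q a)) := by
  have h2 : Real.log 2 ≠ 0 := (Real.log_pos one_lt_two).ne'
  rw [Finset.sum_sub_distrib, Finset.sum_sub_distrib, hs, sub_self, sub_zero, kl, Finset.sum_mul]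
  refine Finset.sum_congr rfl fun a _ => ?_
  rw [Real.logb, mul_assoc, div_mul_cancel₀ _ h2]

lemma mul_log_div_sub_eq {x y : ℝ} (hy : 0 < y) : x * Real.log (x / y) - (x - y) =
    y * (x / y * Real.log (x / y) - (x / y - 1)) := by
  have := hy.ne'
  field_simp

lemma mul_log_div_sub_nonneg {x y : ℝ} (hx : 0 ≤ x) (hy : 0 < y) :
    0 ≤ x * Real.log (x / y) - (x - y) := by
  rw [mul_log_div_sub_eq hy]
  exact mul_nonneg hy.le (sub_nonneg.2 (Real.self_sub_one_le_mul_log (div_nonneg hx hy.le)))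

lemma kl_nonneg {p q : A → ℝ} (hp : ∀ a, 0 ≤ p a) (hq : ∀ a, 0 < q a)
    (hs : ∑ a, p a = ∑ a, q a) : 0 ≤ kl p q := by
  refine nonneg_of_mul_nonneg_left ?_ (Real.log_pos one_lt_two)
  rw [kl_mul_log_two hs]
  exact Finset.sum_nonneg fun a _ => mul_log_div_sub_nonneg (hp a) (hq a)

lemma eq_of_kl_eq_zero {p q : A → ℝ} (hp : ∀ a, 0 ≤ p a) (hq : ∀ a, 0 < q a)
    (hs : ∑ a, p a = ∑ a, q a) (h : kl p q = 0) : p = q := by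
  have hsum := kl_mul_log_two hs
  rw [h, zero_mul, eq_comm, Finset.sum_eq_zero_iff_of_nonneg fun a _ =>
    mul_log_div_sub_nonneg (hp a) (hq a)] at hsum
  funext a
  by_contra hne
  have hlt := Real.self_sub_one_lt_mul_log (div_nonneg (hp a) (hq a).le) fun h1 =>
    hne ((div_eq_one_iff_eq (hq a).ne').1 h1)
  have h0 := hsum a (Finset.mem_univ a)
  rw [mul_log_div_sub_eq (hq a)] at h0
  exact (mul_pos (hq a) (sub_pos.2 hlt)).ne' h0

lemma continuous_ent : Continuous (ent : (A → ℝ) → ℝ) := by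
  unfold ent
  fun_prop

lemma ent_smul (c : ℝ) (p : A → ℝ) :
    ent (c • p) = c * ent p + Real.negMulLog c * ∑ a, p a := by
  simp only [ent, Pi.smul_apply, smul_eq_mul, Real.negMulLog_mul, Finset.sum_add_distrib,
    Finset.mul_sum]
  rw [add_comm]
  exact congrArg _ (Finset.sum_congr rfl fun _ _ => mul_comm _ _)

lemma sum_mul_ent_le {ι : Type*} [Fintype ι] {w : ι → ℝ} (hw : w ∈ stdSimplex ℝ ι)
    {p : ι → A → ℝ} (hp : ∀ i a, 0 ≤ p i a) :
    ∑ i, w i * ent (p i) ≤ ent (∑ i, w i • p i) := by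
  simp only [ent, Finset.mul_sum]
  rw [Finset.sum_comm]
  refine Finset.sum_le_sum fun a _ => ?_
  have := Real.concaveOn_negMulLog.le_map_sum (t := Finset.univ) (w := w) (p := fun i => p i a)
    (fun i _ => hw.1 i) hw.2 fun i _ => hp i a
  simpa using this

/-- The average over `i` of the laws of the coordinates `f i`. -/
noncomputable def avgLaw {n : ℕ} (P : Ω → ℝ) (f : Ω → Fin n → A) (a : A) : ℝ :=
  (∑ i, law P (fun ω => f ω i) a) / n

lemma mul_sum_avgLaw_mul {n : ℕ} (hn : 0 < n) (P : Ω → ℝ) (f : Ω → Fin n → A) (φ : A → ℝ) :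
    n * ∑ a, avgLaw P f a * φ a = ∑ ω, P ω * ∑ i, φ (f ω i) := by
  have hn' : (n : ℝ) ≠ 0 := by positivity
  simp only [avgLaw, div_mul_eq_mul_div, ← Finset.sum_div, mul_div_cancel₀ _ hn']
  simp only [Finset.sum_mul, Finset.mul_sum]
  rw [Finset.sum_comm, Finset.sum_comm (s := Finset.univ (α := Ω))]
  exact Finset.sum_congr rfl fun i _ => sum_law_mul P (fun ω => f ω i) φ

lemma avgLaw_mem_stdSimplex {n : ℕ} (hn : 0 < n) {P : Ω → ℝ} (hP : P ∈ stdSimplex ℝ Ω)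
    (f : Ω → Fin n → A) : avgLaw P f ∈ stdSimplex ℝ A := by
  have hn' : (n : ℝ) ≠ 0 := by positivity
  refine ⟨fun a => div_nonneg (Finset.sum_nonneg fun i _ => law_nonneg hP.1 _ a) (by positivity),
    ?_⟩
  have := mul_sum_avgLaw_mul hn P f fun _ => 1
  simp only [mul_one, Finset.sum_const, Finset.card_univ, Fintype.card_fin, nsmul_eq_mul,
    ← Finset.sum_mul, hP.2, one_mul] at this
  exact mul_left_cancel₀ hn' (by rw [this, mul_one])

/-- Subadditivity of entropy together with its concavity: Gibbs' inequality against the `n`-fold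
product of the average coordinate law. -/
lemma ent_law_le_mul_ent_avgLaw {n : ℕ} (hn : 0 < n) {P : Ω → ℝ} (hP : P ∈ stdSimplex ℝ Ω)
    (f : Ω → Fin n → A) : ent (law P f) ≤ n * ent (avgLaw P f) := by
  have havg := avgLaw_mem_stdSimplex hn hP f
  have hpos : ∀ ω, P ω ≠ 0 → ∀ i, avgLaw P f (f ω i) ≠ 0 := by
    intro ω hω i
    refine (div_pos ?_ (by positivity)).ne'
    exact Finset.sum_pos' (fun j _ => law_nonneg hP.1 _ _)
      ⟨i, Finset.mem_univ i, law_pos hP.1 (fun ω => f ω i) hω⟩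
  have hsum : ∑ t : Fin n → A, ∏ i, avgLaw P f (t i) = 1 := by
    classical
    rw [← Fintype.piFinset_univ, ← Finset.prod_univ_sum]
    simp [havg.2]
  have g := sum_mul_log_le_neg_ent (p := law P f) (q := fun t => ∏ i, avgLaw P f (t i))
    (law_nonneg hP.1 f) (fun t => Finset.prod_nonneg fun i _ => havg.1 _) (by
      intro t ht
      refine Finset.sum_eq_zero fun ω _ => ?_
      split_ifs with h
      · by_contra hω
        subst h
        exact Finset.prod_ne_zero_iff.2 (fun i _ => hpos ω hω i) ht
      · rfl) (by rw [hsum, sum_law, hP.2])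
  rw [sum_law_mul P f fun t => Real.log (∏ i, avgLaw P f (t i))] at g
  have e : (n : ℝ) * ent (avgLaw P f) = -∑ ω, P ω * Real.log (∏ i, avgLaw P f (f ω i)) := by
    have := mul_sum_avgLaw_mul hn P f fun a => Real.log (avgLaw P f a)
    have h3 : ent (avgLaw P f) = -∑ a, avgLaw P f a * Real.log (avgLaw P f a) := by
      simp [ent, Real.negMulLog]
    rw [h3, mul_neg, this]
    congr 1
    refine Finset.sum_congr rfl fun ω _ => ?_
    by_cases hω : P ω = 0
    · simp [hω]
    · rw [Real.log_prod fun i _ => hpos ω hω i]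
  linarith

/-- The divergence of the average coordinate law from `q` is at most the normalized divergence of
the law of the sequence from the `n`-fold product of `q`. -/
lemma mul_kl_avgLaw_le {n : ℕ} (hn : 0 < n) {P : Ω → ℝ} (hP : P ∈ stdSimplex ℝ Ω)
    (f : Ω → Fin n → A) {q : A → ℝ} (hq : ∀ a, 0 < q a) :
    n * kl (avgLaw P f) q ≤ kl (law P f) fun t => ∏ i, q (t i) := by
  have h2 : 0 < Real.log 2 := Real.log_pos one_lt_two
  have expand : ∀ {D : Type _} [Fintype D] (p r : D → ℝ), (∀ d, 0 < r d) →
      kl p r * Real.log 2 = -ent p - ∑ d, p d * Real.log (r d) := by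
    intro D _ p r hr
    rw [kl, Finset.sum_mul, ent, ← Finset.sum_neg_distrib, ← Finset.sum_sub_distrib]
    refine Finset.sum_congr rfl fun d _ => ?_
    by_cases hd : p d = 0
    · simp [hd]
    · rw [Real.logb, Real.log_div hd (hr d).ne', Real.negMulLog]
      field_simp
  have e1 := expand (avgLaw P f) q hq
  have e2 := expand (law P f) (fun t => ∏ i, q (t i)) fun t => Finset.prod_pos fun i _ => hq _
  have e3 : (n : ℝ) * ∑ a, avgLaw P f a * Real.log (q a) =
      ∑ t, law P f t * Real.log (∏ i, q (t i)) := by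
    rw [mul_sum_avgLaw_mul hn, sum_law_mul P f fun t => Real.log (∏ i, q (t i))]
    simp [Real.log_prod fun i _ => (hq _).ne']
  refine le_of_mul_le_mul_right ?_ h2
  have := ent_law_le_mul_ent_avgLaw hn hP f
  rw [e2, mul_assoc, e1, mul_sub, e3]
  linarith

/-- Fano's inequality, from Gibbs' inequality against the kernel which guesses `d b` with
probability one half and is uniform on the messages otherwise. -/
lemma ent_law_pair_sub_le {M : ℕ} {P : Ω → ℝ} (hP : P ∈ stdSimplex ℝ Ω)
    (f : Ω → Fin M) (g : Ω → B) (d : B → Fin M) :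
    ent (law P fun ω => (f ω, g ω)) - ent (law P g) ≤
      Real.log 2 + (∑ ω, if d (g ω) ≠ f ω then P ω else 0) * Real.log M := by
  obtain ⟨ω₀, -⟩ : ∃ ω, P ω ≠ 0 := by
    by_contra! h
    simpa [h] using hP.2
  have hM : 0 < M := (f ω₀).pos
  have hM' : (0 : ℝ) < M := by exact_mod_cast hM
  -- at least `1 / 2` on the guess and at least `1 / (2 * M)` on every message
  set r : Fin M → B → ℝ := fun m b => (1 / 2) * (if d b = m then 1 else 0) + 1 / (2 * M) with hr
  have hrpos : ∀ m b, 0 < r m b := fun m b => by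
    simp only [hr]; split_ifs <;> positivity
  have hrsum : ∀ b, ∑ m, r m b = 1 := fun b => by
    simp only [hr, Finset.sum_add_distrib, ← Finset.mul_sum]
    simp
    field_simp
    norm_num
  have g1 := sum_mul_log_le_neg_ent (p := law P fun ω => (f ω, g ω))
    (q := fun q => r q.1 q.2 * law P g q.2) (law_nonneg hP.1 _)
    (fun q => mul_nonneg (hrpos _ _).le (law_nonneg hP.1 _ _)) (by
      rintro ⟨m, b⟩ h
      have h' : law P g b = 0 := by simpa [(hrpos m b).ne'] using h
      refine Finset.sum_eq_zero fun ω _ => ?_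
      split_ifs with h3
      · by_contra hω
        obtain ⟨rfl, rfl⟩ := Prod.mk.inj h3
        exact (law_pos hP.1 g hω).ne' h'
      · rfl) (by
      rw [Fintype.sum_prod_type, Finset.sum_comm]
      simp only [← Finset.sum_mul, hrsum, one_mul, sum_law]
      exact le_rfl)
  rw [sum_law_mul P (fun ω => (f ω, g ω)) fun q => Real.log (r q.1 q.2 * law P g q.2)] at g1
  have e : ∑ ω, P ω * Real.log (r (f ω) (g ω) * law P g (g ω)) =
      ∑ ω, P ω * Real.log (r (f ω) (g ω)) - ent (law P g) := by
    rw [ent_law, sub_neg_eq_add, ← Finset.sum_add_distrib]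
    refine Finset.sum_congr rfl fun ω _ => ?_
    by_cases hω : P ω = 0
    · simp [hω]
    · rw [Real.log_mul (hrpos _ _).ne' (law_pos hP.1 g hω).ne']
      ring
  have bound : -∑ ω, P ω * Real.log (r (f ω) (g ω)) ≤
      ∑ ω, (P ω * Real.log 2 + (if d (g ω) ≠ f ω then P ω else 0) * Real.log M) := by
    rw [← Finset.sum_neg_distrib]
    refine Finset.sum_le_sum fun ω _ => ?_
    rw [← mul_neg, ← Real.log_inv]
    by_cases h : d (g ω) = f ω
    · have : (r (f ω) (g ω))⁻¹ ≤ 2 := by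
        rw [inv_le_comm₀ (hrpos _ _) two_pos]
        simp only [hr, h, if_true]
        have : 0 < 1 / (2 * (M : ℝ)) := by positivity
        linarith
      have := mul_le_mul_of_nonneg_left (Real.log_le_log (inv_pos.2 (hrpos _ _)) this) (hP.1 ω)
      simpa [h] using this
    · have : (r (f ω) (g ω))⁻¹ = 2 * M := by simp [hr, h]
      rw [this, Real.log_mul two_ne_zero hM'.ne', if_pos h, mul_add]
  rw [Finset.sum_add_distrib, ← Finset.sum_mul, ← Finset.sum_mul, hP.2, one_mul] at bound
  linarith

end Entropy

/-! ### Product measures and convex hulls -/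

/-- Under a product measure whose `i`-th factor is a probability mass function, the `i`-th
coordinate is independent of every function of the remaining ones. -/
lemma sum_prod_mul_mul_eq {ι B : Type*} [Fintype ι] [DecidableEq ι] [Fintype B] (p : ι → B → ℝ) (i : ι)
    (hp : ∑ b, p i b = 1) (φ : (ι → B) → ℝ)
    (hφ : ∀ t t' : ι → B, (∀ j, j ≠ i → t j = t' j) → φ t = φ t') (ψ : B → ℝ) :
    ∑ t, (∏ j, p j (t j)) * (φ t * ψ (t i)) =
      (∑ b, p i b * ψ b) * ∑ t, (∏ j, p j (t j)) * φ t := by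
  have hinv : Function.Involutive
      (fun x : (ι → B) × B => (Function.update x.1 i x.2, x.1 i)) := by
    rintro ⟨t, b⟩
    simp
  -- exchange the `i`-th coordinate with an independent copy
  have h := Equiv.sum_comp hinv.toPerm
    fun x : (ι → B) × B => p i x.2 * ((∏ j, p j (x.1 j)) * (φ x.1 * ψ (x.1 i)))
  rw [Fintype.sum_prod_type, Fintype.sum_prod_type_right] at h
  simp only [← Finset.sum_mul, ← Finset.mul_sum, hp, one_mul] at h
  rw [← h, Finset.sum_mul, Finset.sum_comm]
  refine Finset.sum_congr rfl fun b _ => ?_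
  rw [Finset.mul_sum]
  refine Finset.sum_congr rfl fun t _ => ?_
  have e1 : φ (Function.update t i b) = φ t :=
    hφ _ _ fun j hj => by simp [Function.update_of_ne hj]
  have e2 : p i (t i) * ∏ j, p j (Function.update t i b j) = p i b * ∏ j, p j (t j) := by
    rw [← Finset.mul_prod_erase Finset.univ (fun j => p j (t j)) (Finset.mem_univ i),
      ← Finset.mul_prod_erase Finset.univ (fun j => p j (Function.update t i b j))
        (Finset.mem_univ i)]
    rw [Finset.prod_congr rfl (g := fun j => p j (t j)) fun j hj => by
      simp [Function.update_of_ne (Finset.ne_of_mem_erase hj)]]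
    simp only [Function.update_self]
    ring
  change p i (t i) * ((∏ j, p j (Function.update t i b j)) *
    (φ (Function.update t i b) * ψ (Function.update t i b i))) = _
  rw [e1, Function.update_self, ← mul_assoc, e2]
  ring

/-- Carathéodory's theorem with a fixed number of points. -/
lemma exists_fin_of_mem_convexHull {E : Type*} [AddCommGroup E] [Module ℝ E]
    [FiniteDimensional ℝ E] {s : Set E} {x : E} (hx : x ∈ convexHull ℝ s) :
    ∃ w ∈ stdSimplex ℝ (Fin (Module.finrank ℝ E + 1)),
      ∃ z : Fin (Module.finrank ℝ E + 1) → E, (∀ i, z i ∈ s) ∧ ∑ i, w i • z i = x := by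
  obtain ⟨ι, _, z, w, hz, hind, hw, hw1, hx'⟩ := eq_pos_convex_span_of_mem_convexHull hx
  have hcard : Fintype.card ι ≤ Module.finrank ℝ E + 1 :=
    hind.card_le_finrank_succ.trans (Nat.add_le_add_right (Submodule.finrank_le _) 1)
  obtain ⟨e⟩ : Nonempty (ι ↪ Fin (Module.finrank ℝ E + 1)) :=
    Function.Embedding.nonempty_of_card_le (by simpa using hcard)
  obtain ⟨z₀, hz₀⟩ : s.Nonempty := convexHull_nonempty_iff.1 ⟨x, hx⟩
  have hext : ∀ i ∉ Set.range e, Function.extend e w 0 i = 0 := fun i hi => by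
    rw [Function.extend_apply' _ _ _ (by simpa using hi)]; rfl
  refine ⟨Function.extend e w 0, ⟨fun i => ?_, ?_⟩, Function.extend e z fun _ => z₀,
    fun i => ?_, ?_⟩
  · by_cases hi : i ∈ Set.range e
    · obtain ⟨j, rfl⟩ := hi
      rw [e.injective.extend_apply]
      exact (hw j).le
    · rw [hext i hi]
  · rw [← hw1]
    exact (Fintype.sum_of_injective e e.injective _ _ hext
      fun j => (e.injective.extend_apply _ _ j).symm).symm
  · by_cases hi : i ∈ Set.range e
    · obtain ⟨j, rfl⟩ := hi
      rw [e.injective.extend_apply]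
      exact hz ⟨j, rfl⟩
    · rwa [Function.extend_apply' _ _ _ (by simpa using hi)]
  · rw [← hx']
    exact (Fintype.sum_of_injective e e.injective _ _ (fun i hi => by rw [hext i hi, zero_smul])
      fun j => by rw [e.injective.extend_apply, e.injective.extend_apply]).symm

lemma IsCompact.convexHull_of_finiteDimensional {E : Type*} [AddCommGroup E] [Module ℝ E]
    [TopologicalSpace E] [IsTopologicalAddGroup E] [ContinuousSMul ℝ E]
    [FiniteDimensional ℝ E] {s : Set E} (hs : IsCompact s) : IsCompact (convexHull ℝ s) := by
  have hc := (isCompact_stdSimplex ℝ (Fin (Module.finrank ℝ E + 1))).prod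
    (isCompact_univ_pi fun _ : Fin (Module.finrank ℝ E + 1) => hs)
  have hf : Continuous fun x : (Fin (Module.finrank ℝ E + 1) → ℝ) ×
      (Fin (Module.finrank ℝ E + 1) → E) => ∑ i, x.1 i • x.2 i := by fun_prop
  convert hc.image hf using 1
  ext x
  constructor
  · intro hx
    obtain ⟨w, hw, z, hz, rfl⟩ := exists_fin_of_mem_convexHull hx
    exact ⟨(w, z), ⟨hw, fun i _ => hz i⟩, rfl⟩
  · rintro ⟨⟨w, z⟩, ⟨hw, hz⟩, rfl⟩
    exact (convex_convexHull ℝ s).sum_mem (fun i _ => hw.1 i) hw.2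
      fun i _ => subset_convexHull ℝ s (hz i trivial)

/-! ### The Gelfand–Pinsker functional on input distributions -/

namespace StateChannel

variable {X S Y Z : Type*}

/-- The state marginal of a measure on states and inputs. -/
noncomputable def stateMarg [Fintype X] : (S × X → ℝ) →ₗ[ℝ] S → ℝ where
  toFun μ s := ∑ x, μ (s, x)
  map_add' μ ν := by ext s; simp [Finset.sum_add_distrib]
  map_smul' c μ := by ext s; simp [Finset.mul_sum]

open Classical in
/-- The measure on states and inputs with state marginal `q` and input `w s` in state `s`. -/
noncomputable def detInput (w : S → X) : (S → ℝ) →ₗ[ℝ] S × X → ℝ where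
  toFun q p := if p.2 = w p.1 then q p.1 else 0
  map_add' q r := by ext p; by_cases h : p.2 = w p.1 <;> simp [h]
  map_smul' c q := by ext p; by_cases h : p.2 = w p.1 <;> simp [h]

lemma stateMarg_detInput [Fintype X] (w : S → X) (q : S → ℝ) : stateMarg (detInput w q) = q := by
  classical
  ext s
  change ∑ x, (if x = w s then q s else 0) = q s
  simp

variable [Fintype S] [Fintype Y] [Fintype Z]

/-- The probability of the legitimate output `y` given the input `x` and the state `s`. -/
noncomputable def WY (ch : StateChannel X S Y Z) (x : X) (s : S) (y : Y) : ℝ :=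
  ∑ z, ch.W x s (y, z)

/-- The probability of the warden's output `z` given the input `x` and the state `s`. -/
noncomputable def WZ (ch : StateChannel X S Y Z) (x : X) (s : S) (z : Z) : ℝ :=
  ∑ y, ch.W x s (y, z)

lemma WY_mem (ch : StateChannel X S Y Z) (x : X) (s : S) : ch.WY x s ∈ stdSimplex ℝ Y :=
  ⟨fun y => Finset.sum_nonneg fun z _ => (ch.W_mem x s).1 _, by
    rw [← (ch.W_mem x s).2, Fintype.sum_prod_type]; rfl⟩

open Classical in
/-- The measure on states and inputs obtained by restricting `auxJoint` to the value `u` of the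
first auxiliary variable. -/
noncomputable def auxInput {U V : Type*} [Fintype V] (ch : StateChannel X S Y Z) (PUV : S → U × V → ℝ) (x : U → S → X)
    (u : U) : S × X → ℝ :=
  fun p => ch.QS p.1 * (∑ v, PUV p.1 (u, v)) * if p.2 = x u p.1 then 1 else 0

lemma auxInput_nonneg {U V : Type*} [Fintype U] [Fintype V] (ch : StateChannel X S Y Z) {PUV : S → U × V → ℝ}
    (hP : ∀ s, PUV s ∈ stdSimplex ℝ (U × V)) (x : U → S → X) (u : U) (p : S × X) :
    0 ≤ ch.auxInput PUV x u p := by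
  refine mul_nonneg (mul_nonneg (ch.QS_mem.1 _) (Finset.sum_nonneg fun v _ => (hP _).1 _)) ?_
  split_ifs <;> simp

lemma auxJoint_nonneg {U V : Type*} [Fintype U] [Fintype V] (ch : StateChannel X S Y Z) {PUV : S → U × V → ℝ}
    (hP : ∀ s, PUV s ∈ stdSimplex ℝ (U × V)) (x : U → S → X) (ω : S × U × V × X × Y × Z) :
    0 ≤ ch.auxJoint PUV x ω := by
  obtain ⟨s, u, v, a, y, z⟩ := ω
  refine mul_nonneg (mul_nonneg (mul_nonneg (ch.QS_mem.1 _) ((hP _).1 _)) ?_) ((ch.W_mem _ _).1 _)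
  split_ifs <;> simp

variable [Fintype X]

/-- The measure at the legitimate receiver's output induced by a measure on states and inputs. -/
noncomputable def outY (ch : StateChannel X S Y Z) : (S × X → ℝ) →ₗ[ℝ] Y → ℝ where
  toFun μ y := ∑ p, μ p * ch.WY p.2 p.1 y
  map_add' μ ν := by ext y; simp [Finset.sum_add_distrib, add_mul]
  map_smul' c μ := by ext y; simp [Finset.mul_sum, mul_assoc]

/-- The measure at the warden's output induced by a measure on states and inputs. -/
noncomputable def outZ (ch : StateChannel X S Y Z) : (S × X → ℝ) →ₗ[ℝ] Z → ℝ where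
  toFun μ z := ∑ p, μ p * ch.WZ p.2 p.1 z
  map_add' μ ν := by ext y; simp [Finset.sum_add_distrib, add_mul]
  map_smul' c μ := by ext y; simp [Finset.mul_sum, mul_assoc]

/-- The difference `H(S) - H(Y)` for a measure on states and inputs. Both entropies are of vectors
of the same total mass, which makes the difference positively homogeneous. -/
noncomputable def gain (ch : StateChannel X S Y Z) (μ : S × X → ℝ) : ℝ :=
  ent (stateMarg μ) - ent (ch.outY μ)

/-- The graph of `gain` over the distributions on `S × X` in which the input is a function of the
state. These describe the conditional law given a value `u` of the auxiliary variable. -/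
def strategyGraph (ch : StateChannel X S Y Z) : Set ((S × X → ℝ) × ℝ) :=
  ⋃ w : S → X, (fun q => (detInput w q, ch.gain (detInput w q))) '' stdSimplex ℝ S

/-- The value of the Gelfand–Pinsker functional `I(U;Y) - I(U;S)`, in nats: `c.1` is the law of
`(S, X)` and `c.2` is `H(S|U) - H(Y|U)`. -/
noncomputable def objective (ch : StateChannel X S Y Z) (c : (S × X → ℝ) × ℝ) : ℝ :=
  c.2 - ch.gain c.1

/-- The convex combinations of points of `strategyGraph` with the prescribed state law and for
which the warden's output has the law induced by the innocent symbol. -/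
def feasible (ch : StateChannel X S Y Z) : Set ((S × X → ℝ) × ℝ) :=
  {c ∈ convexHull ℝ ch.strategyGraph | stateMarg c.1 = ch.QS ∧ ch.outZ c.1 = ch.Q₀}

lemma sum_stateMarg (μ : S × X → ℝ) : ∑ s, stateMarg μ s = ∑ p, μ p := by
  rw [Fintype.sum_prod_type]; rfl

lemma sum_outY (ch : StateChannel X S Y Z) (μ : S × X → ℝ) : ∑ y, ch.outY μ y = ∑ p, μ p := by
  change ∑ y, ∑ p, μ p * ch.WY p.2 p.1 y = _
  rw [Finset.sum_comm]
  exact Finset.sum_congr rfl fun p _ => by rw [← Finset.mul_sum, (ch.WY_mem _ _).2, mul_one]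

lemma outY_nonneg (ch : StateChannel X S Y Z) {μ : S × X → ℝ} (hμ : ∀ p, 0 ≤ μ p) (y : Y) :
    0 ≤ ch.outY μ y :=
  Finset.sum_nonneg fun p _ => mul_nonneg (hμ p) ((ch.WY_mem _ _).1 y)

lemma gain_smul (ch : StateChannel X S Y Z) (c : ℝ) (μ : S × X → ℝ) :
    ch.gain (c • μ) = c * ch.gain μ := by
  rw [gain, map_smul, map_smul, ent_smul, ent_smul, sum_stateMarg, sum_outY, gain]
  ring

lemma continuous_gain (ch : StateChannel X S Y Z) : Continuous ch.gain :=
  (continuous_ent.comp (LinearMap.continuous_of_finiteDimensional _)).sub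
    (continuous_ent.comp (LinearMap.continuous_of_finiteDimensional _))

lemma continuous_objective (ch : StateChannel X S Y Z) : Continuous ch.objective :=
  continuous_snd.sub (ch.continuous_gain.comp continuous_fst)

lemma isCompact_convexHull_strategyGraph (ch : StateChannel X S Y Z) :
    IsCompact (convexHull ℝ ch.strategyGraph) := by
  refine IsCompact.convexHull_of_finiteDimensional (isCompact_iUnion fun w => ?_)
  have h : Continuous (detInput w) := LinearMap.continuous_of_finiteDimensional (detInput w)
  exact (isCompact_stdSimplex ℝ S).image (h.prodMk (ch.continuous_gain.comp h))

lemma isCompact_feasible (ch : StateChannel X S Y Z) : IsCompact ch.feasible := by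
  refine ch.isCompact_convexHull_strategyGraph.inter_right (IsClosed.inter ?_ ?_)
  · exact isClosed_eq ((LinearMap.continuous_of_finiteDimensional stateMarg).comp continuous_fst)
      continuous_const
  · exact isClosed_eq ((LinearMap.continuous_of_finiteDimensional ch.outZ).comp continuous_fst)
      continuous_const

/-- A randomized input is a mixture of inputs that are functions of the state (each function drawn
with independent values), and since `H(Y)` is concave, revealing the function does not decrease
`H(S|U) - H(Y|U)`. -/
lemma exists_mem_convexHull_of_nonneg (ch : StateChannel X S Y Z) {μ : S × X → ℝ}
    (hμ : ∀ p, 0 ≤ μ p) :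
    ∃ c ∈ convexHull ℝ ch.strategyGraph,
      μ = (∑ p, μ p) • c.1 ∧ ch.gain μ ≤ (∑ p, μ p) * c.2 := by
  classical
  have hmem : ∀ (w : S → X) {q : S → ℝ}, q ∈ stdSimplex ℝ S →
      (detInput w q, ch.gain (detInput w q)) ∈ convexHull ℝ ch.strategyGraph := fun w q hq =>
    subset_convexHull ℝ _ (Set.mem_iUnion.2 ⟨w, q, hq, rfl⟩)
  set r := ∑ p, μ p with hr
  rcases (Finset.sum_nonneg fun p _ => hμ p : 0 ≤ r).eq_or_lt with h0 | hpos
  · have hz : μ = 0 := by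
      ext p
      exact (Finset.sum_eq_zero_iff_of_nonneg fun p _ => hμ p).1 (hr ▸ h0.symm) p
        (Finset.mem_univ p)
    have h0' : r = 0 := by rw [hr, ← h0]
    refine ⟨_, hmem (fun _ => ch.x₀) ch.QS_mem, by rw [h0', zero_smul, hz], ?_⟩
    have := ch.gain_smul 0 μ
    rw [zero_smul, zero_mul, ← hz] at this
    rw [this, h0', zero_mul]
  set σ := stateMarg μ with hσ
  have hσ0 : ∀ s, 0 ≤ σ s := fun s => Finset.sum_nonneg fun x _ => hμ _
  set q : S → ℝ := r⁻¹ • σ with hq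
  have hqmem : q ∈ stdSimplex ℝ S := by
    refine ⟨fun s => mul_nonneg (inv_pos.2 hpos).le (hσ0 s), ?_⟩
    simp only [hq, Pi.smul_apply, smul_eq_mul, ← Finset.mul_sum, hσ, sum_stateMarg]
    exact inv_mul_cancel₀ hpos.ne'
  -- the conditional law of the input given the state, extended arbitrarily to null states
  set κ : S → X → ℝ := fun s x =>
    if σ s = 0 then (if x = ch.x₀ then 1 else 0) else μ (s, x) / σ s with hκ
  have hκ0 : ∀ s x, 0 ≤ κ s x := fun s x => by
    simp only [hκ]
    split_ifs
    exacts [zero_le_one, le_rfl, div_nonneg (hμ _) (hσ0 s)]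
  have hκ1 : ∀ s, ∑ x, κ s x = 1 := fun s => by
    simp only [hκ]
    split_ifs with h
    · simp
    · rw [← Finset.sum_div]
      exact div_self h
  have hκσ : ∀ s x, σ s * κ s x = μ (s, x) := fun s x => by
    simp only [hκ]
    split_ifs with h h'
    · rw [h, zero_mul]
      exact ((Finset.sum_eq_zero_iff_of_nonneg fun x _ => hμ (s, x)).1 h x
        (Finset.mem_univ x)).symm
    · rw [h, zero_mul]
      exact ((Finset.sum_eq_zero_iff_of_nonneg fun x _ => hμ (s, x)).1 h x
        (Finset.mem_univ x)).symm
    · field_simp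
  set p : (S → X) → ℝ := fun w => ∏ s, κ s (w s) with hp
  have hpmem : p ∈ stdSimplex ℝ (S → X) := by
    refine ⟨fun w => Finset.prod_nonneg fun s _ => hκ0 _ _, ?_⟩
    rw [hp, ← Fintype.piFinset_univ, ← Finset.prod_univ_sum]
    simp [hκ1]
  have hfst : ∑ w, p w • detInput w q = r⁻¹ • μ := by
    ext ⟨s, x⟩
    have h := sum_prod_mul_mul_eq κ s (hκ1 s) (fun _ => q s) (fun _ _ _ => rfl)
      fun b => if x = b then 1 else 0
    rw [← Finset.sum_mul] at h
    change _ = _ * ((∑ w, p w) * q s) at h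
    rw [hpmem.2] at h
    simp only [Finset.sum_apply, Pi.smul_apply, smul_eq_mul]
    calc ∑ w, p w * detInput w q (s, x)
        = ∑ w, p w * (q s * if x = w s then 1 else 0) := by
          refine Finset.sum_congr rfl fun w _ => ?_
          change _ * (if x = w s then q s else 0) = _
          simp
      _ = _ := h
      _ = r⁻¹ * μ (s, x) := by
          rw [← hκσ s x]
          simp [hq]
          ring
  refine ⟨∑ w, p w • (detInput w q, ch.gain (detInput w q)),
    (convex_convexHull ℝ _).sum_mem (fun w _ => hpmem.1 w) hpmem.2 fun w _ => hmem w hqmem, ?_, ?_⟩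
  · rw [Prod.fst_sum]
    simp only [Prod.smul_mk, hfst]
    rw [smul_smul, mul_inv_cancel₀ hpos.ne', one_smul]
  · rw [Prod.snd_sum]
    simp only [Prod.smul_mk, smul_eq_mul]
    have hconc := sum_mul_ent_le hpmem (p := fun w => ch.outY (detInput w q)) fun w =>
      ch.outY_nonneg fun p => by
        change 0 ≤ if p.2 = w p.1 then q p.1 else 0
        split_ifs
        exacts [hqmem.1 _, le_rfl]
    have hout : ∑ w, p w • ch.outY (detInput w q) = ch.outY (r⁻¹ • μ) := by
      rw [← hfst, map_sum]
      simp only [map_smul]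
    have hg : ch.gain μ = r * ch.gain (r⁻¹ • μ) := by
      rw [gain_smul, mul_inv_cancel_left₀ hpos.ne']
    rw [hg]
    refine mul_le_mul_of_nonneg_left ?_ hpos.le
    simp only [gain, stateMarg_detInput, mul_sub, Finset.sum_sub_distrib, ← Finset.sum_mul,
      hpmem.2, one_mul, ← hout, map_smul stateMarg]
    exact sub_le_sub_left hconc _

lemma exists_mem_convexHull_of_sum (ch : StateChannel X S Y Z) {J : Type*} [Fintype J]
    {μ : J → S × X → ℝ} (hμ : ∀ j p, 0 ≤ μ j p) (hμ1 : ∑ j, ∑ p, μ j p = 1) :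
    ∃ c ∈ convexHull ℝ ch.strategyGraph,
      c.1 = ∑ j, μ j ∧ ∑ j, ch.gain (μ j) - ch.gain (∑ j, μ j) ≤ ch.objective c := by
  choose c hc h1 h2 using fun j => ch.exists_mem_convexHull_of_nonneg (hμ j)
  have e : (∑ j, (∑ p, μ j p) • c j).1 = ∑ j, μ j := by
    rw [Prod.fst_sum]
    exact Finset.sum_congr rfl fun j _ => (h1 j).symm
  refine ⟨∑ j, (∑ p, μ j p) • c j, (convex_convexHull ℝ _).sum_mem
    (fun j _ => Finset.sum_nonneg fun p _ => hμ j p) hμ1 fun j _ => hc j, e, ?_⟩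
  rw [objective, e, Prod.snd_sum]
  exact sub_le_sub_right (Finset.sum_le_sum fun j _ => h2 j) _

/-! ### The single-letter region -/

section Region

variable {U V : Type*} [Fintype U] [Fintype V]

/-- Expectations under `auxJoint` of functions not depending on the second auxiliary variable. -/
lemma sum_auxJoint_mul (ch : StateChannel X S Y Z) (PUV : S → U × V → ℝ) (x : U → S → X)
    (φ : S → U → X → Y → Z → ℝ) :
    ∑ ω, ch.auxJoint PUV x ω * φ ω.1 ω.2.1 ω.2.2.2.1 ω.2.2.2.2.1 ω.2.2.2.2.2 =
      ∑ u, ∑ p : S × X, ch.auxInput PUV x u p *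
        ∑ y, ∑ z, ch.W p.2 p.1 (y, z) * φ p.1 u p.2 y z := by
  classical
  simp only [Fintype.sum_prod_type, auxJoint, auxInput]
  rw [Finset.sum_comm]
  refine Finset.sum_congr rfl fun u _ => Finset.sum_congr rfl fun s _ => ?_
  rw [Finset.sum_comm]
  refine Finset.sum_congr rfl fun a _ => ?_
  simp only [Finset.mul_sum, Finset.sum_mul]
  rw [Finset.sum_comm]
  refine Finset.sum_congr rfl fun y _ => ?_
  rw [Finset.sum_comm]
  refine Finset.sum_congr rfl fun z _ => Finset.sum_congr rfl fun v _ => ?_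
  by_cases h : a = x u s <;> simp [h, mul_assoc]

lemma law_auxJoint_state (ch : StateChannel X S Y Z) (PUV : S → U × V → ℝ) (x : U → S → X)
    (u : U) (s : S) :
    law (ch.auxJoint PUV x) (fun ω => (ω.2.1, ω.1)) (u, s) = stateMarg (ch.auxInput PUV x u) s := by
  classical
  rw [law_eq_sum_mul]
  have h1 : ∀ a t, ∑ y, ∑ z, ch.W a t (y, z) = 1 := fun a t => by
    rw [← Fintype.sum_prod_type (f := ch.W a t), (ch.W_mem a t).2]
  refine (ch.sum_auxJoint_mul PUV x
    (fun s' u' _ _ _ => if (u', s') = (u, s) then 1 else 0)).trans ?_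
  simp only [← Finset.sum_mul, h1, Fintype.sum_prod_type, Prod.mk.injEq, ite_and]
  rw [Finset.sum_eq_single u (fun u' _ h => by simp [h]) (by simp),
    Finset.sum_eq_single s (fun s' _ h => by simp [h]) (by simp)]
  simp [stateMarg]

lemma law_auxJoint_outY (ch : StateChannel X S Y Z) (PUV : S → U × V → ℝ) (x : U → S → X)
    (u : U) (y : Y) :
    law (ch.auxJoint PUV x) (fun ω => (ω.2.1, ω.2.2.2.2.1)) (u, y) =
      ch.outY (ch.auxInput PUV x u) y := by
  classical
  rw [law_eq_sum_mul]
  refine (ch.sum_auxJoint_mul PUV x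
    (fun _ u' _ y' _ => if (u', y') = (u, y) then 1 else 0)).trans ?_
  rw [Finset.sum_eq_single u (fun u' _ h => by simp [h]) (by simp)]
  refine Finset.sum_congr rfl fun p _ => ?_
  rw [Finset.sum_eq_single y (fun y' _ h => by simp [h]) (by simp)]
  simp [WY]

lemma law_auxJoint_outZ (ch : StateChannel X S Y Z) (PUV : S → U × V → ℝ) (x : U → S → X) :
    law (ch.auxJoint PUV x) (fun ω => ω.2.2.2.2.2) = ch.outZ (∑ u, ch.auxInput PUV x u) := by
  classical
  ext z
  rw [law_eq_sum_mul, map_sum, Finset.sum_apply]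
  refine (ch.sum_auxJoint_mul PUV x (fun _ _ _ _ z' => if z' = z then 1 else 0)).trans ?_
  refine Finset.sum_congr rfl fun u _ => Finset.sum_congr rfl fun p _ => ?_
  simp [WZ]

lemma stateMarg_sum_auxInput (ch : StateChannel X S Y Z) {PUV : S → U × V → ℝ}
    (hP : ∀ s, PUV s ∈ stdSimplex ℝ (U × V)) (x : U → S → X) :
    stateMarg (∑ u, ch.auxInput PUV x u) = ch.QS := by
  classical
  ext s
  have h : ∑ u, ∑ v, PUV s (u, v) = 1 := by rw [← Fintype.sum_prod_type, (hP s).2]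
  rw [map_sum, Finset.sum_apply]
  simp [stateMarg, auxInput, ← Finset.mul_sum, h]

lemma auxJoint_mem_stdSimplex (ch : StateChannel X S Y Z) {PUV : S → U × V → ℝ}
    (hP : ∀ s, PUV s ∈ stdSimplex ℝ (U × V)) (x : U → S → X) :
    ch.auxJoint PUV x ∈ stdSimplex ℝ (S × U × V × X × Y × Z) := by
  refine ⟨ch.auxJoint_nonneg hP x, ?_⟩
  rw [← sum_law _ (fun ω => (ω.2.1, ω.1)), Fintype.sum_prod_type]
  simp only [law_auxJoint_state]
  rw [Finset.sum_comm, ← ch.QS_mem.2]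
  refine Finset.sum_congr rfl fun s _ => ?_
  rw [← ch.stateMarg_sum_auxInput hP x, map_sum, Finset.sum_apply]

lemma mutualInfo_sub_mutualInfo_auxJoint (ch : StateChannel X S Y Z) {PUV : S → U × V → ℝ}
    (hP : ∀ s, PUV s ∈ stdSimplex ℝ (U × V)) (x : U → S → X) :
    (mutualInfo (ch.auxJoint PUV x) (fun ω => ω.2.1) (fun ω => ω.2.2.2.2.1)
        - mutualInfo (ch.auxJoint PUV x) (fun ω => ω.2.1) (fun ω => ω.1)) * Real.log 2 =
      ∑ u, ch.gain (ch.auxInput PUV x u) - ch.gain (∑ u, ch.auxInput PUV x u) := by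
  have h0 := ch.auxJoint_nonneg hP x
  have hY : law (ch.auxJoint PUV x) (fun ω => ω.2.2.2.2.1) =
      ch.outY (∑ u, ch.auxInput PUV x u) := by
    ext y
    rw [← sum_law_pair_left _ (fun ω => ω.2.1), map_sum, Finset.sum_apply]
    simp only [law_auxJoint_outY]
  have hS : law (ch.auxJoint PUV x) (fun ω => ω.1) =
      stateMarg (∑ u, ch.auxInput PUV x u) := by
    ext s
    rw [← sum_law_pair_left _ (fun ω => ω.2.1), map_sum, Finset.sum_apply]
    simp only [law_auxJoint_state]
  have hUS : ent (law (ch.auxJoint PUV x) fun ω => (ω.2.1, ω.1)) =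
      ∑ u, ent (stateMarg (ch.auxInput PUV x u)) := by
    simp only [ent, Fintype.sum_prod_type, law_auxJoint_state]
  have hUY : ent (law (ch.auxJoint PUV x) fun ω => (ω.2.1, ω.2.2.2.2.1)) =
      ∑ u, ent (ch.outY (ch.auxInput PUV x u)) := by
    simp only [ent, Fintype.sum_prod_type, law_auxJoint_outY]
  rw [sub_mul, mutualInfo_mul_log_two h0, mutualInfo_mul_log_two h0, hUS, hUY, hY, hS]
  simp only [gain, Finset.sum_sub_distrib]
  ring

lemma exists_feasible_of_admissible (ch : StateChannel X S Y Z)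
    {P : S × U × V × X × Y × Z → ℝ} (hP : P ∈ ch.admissible U V) :
    ∃ c ∈ ch.feasible, rateBound P * Real.log 2 ≤ ch.objective c := by
  obtain ⟨⟨PUV, x, hPUV, rfl⟩, hZ, -⟩ := hP
  have h1 : ∑ u, ∑ p, ch.auxInput PUV x u p = 1 := by
    have := sum_stateMarg (∑ u, ch.auxInput PUV x u)
    rw [ch.stateMarg_sum_auxInput hPUV, ch.QS_mem.2] at this
    rw [this, Finset.sum_comm]
    simp only [Finset.sum_apply]
  obtain ⟨c, hc, hc1, hc2⟩ := ch.exists_mem_convexHull_of_sum (ch.auxInput_nonneg hPUV x) h1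
  refine ⟨c, ⟨hc, by rw [hc1, ch.stateMarg_sum_auxInput hPUV], ?_⟩, le_trans ?_ hc2⟩
  · rw [hc1, ← law_auxJoint_outZ]
    exact hZ
  · rw [← ch.mutualInfo_sub_mutualInfo_auxJoint hPUV]
    exact mul_le_mul_of_nonneg_right (min_le_left _ _) (Real.log_pos one_lt_two).le

/-- For a constant second auxiliary variable the two terms of `rateBound` agree. -/
lemma rateBound_auxJoint_of_subsingleton [Subsingleton V] (ch : StateChannel X S Y Z)
    {PUV : S → U × V → ℝ} (hP : ∀ s, PUV s ∈ stdSimplex ℝ (U × V)) (x : U → S → X) :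
    rateBound (ch.auxJoint PUV x) =
      mutualInfo (ch.auxJoint PUV x) (fun ω => ω.2.1) (fun ω => ω.2.2.2.2.1)
        - mutualInfo (ch.auxJoint PUV x) (fun ω => ω.2.1) (fun ω => ω.1) := by
  have hmem := ch.auxJoint_mem_stdSimplex hP x
  have h1 := condMutualInfo_subsingleton hmem (fun ω => ω.2.1) (fun ω => ω.1) (fun ω => ω.2.2.1)
  have h2 := mutualInfo_congr_left hmem.1 (f := fun ω => (ω.2.1, ω.2.2.1)) (f' := fun ω => ω.2.1)
    (fun ω => ω.2.2.2.2.1) (by simp [eq_iff_true_of_subsingleton])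
  change min _ (mutualInfo (ch.auxJoint PUV x) (fun ω => (ω.2.1, ω.2.2.1)) (fun ω => ω.2.2.2.2.1)
    - condMutualInfo (ch.auxJoint PUV x) (fun ω => ω.2.1) (fun ω => ω.1) (fun ω => ω.2.2.1)) = _
  rw [h1, h2]
  exact min_self _

/-- A feasible point of nonnegative objective comes from an admissible law whose second auxiliary
variable is constant; the values of the first one index a Carathéodory decomposition. -/
lemma exists_admissible_of_feasible (ch : StateChannel X S Y Z) {c : (S × X → ℝ) × ℝ}
    (hc : c ∈ ch.feasible) (h0 : 0 ≤ ch.objective c) :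
    ∃ P ∈ ch.admissible (Fin (Fintype.card X * Fintype.card S + 2)) (Fin 1),
      rateBound P * Real.log 2 = ch.objective c := by
  classical
  obtain ⟨hc, hS, hZ⟩ := hc
  have hdim : Module.finrank ℝ ((S × X → ℝ) × ℝ) + 1 = Fintype.card X * Fintype.card S + 2 := by
    simp [mul_comm]
  have hcar := exists_fin_of_mem_convexHull hc
  rw [hdim] at hcar
  obtain ⟨w, hw, z, hz, hsum⟩ := hcar
  have hz' : ∀ u, ∃ (x : S → X) (q : S → ℝ), q ∈ stdSimplex ℝ S ∧
      (detInput x q, ch.gain (detInput x q)) = z u := fun u => by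
    obtain ⟨x, q, hq, h⟩ := Set.mem_iUnion.1 (hz u)
    exact ⟨x, q, hq, h⟩
  choose x q hq hzu using hz'
  have hfst : ∑ u, w u • detInput (x u) (q u) = c.1 := by
    rw [← hsum, Prod.fst_sum]
    simp only [← hzu, Prod.smul_mk]
  have hsnd : ∑ u, w u * ch.gain (detInput (x u) (q u)) = c.2 := by
    rw [← hsum, Prod.snd_sum]
    simp only [← hzu, Prod.smul_mk, smul_eq_mul]
  have hQ : ∀ s, ∑ u, w u * q u s = ch.QS s := fun s => by
    rw [← hS, ← hfst, map_sum, Finset.sum_apply]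
    simp [stateMarg_detInput]
  -- Bayes' rule; states of probability zero get an arbitrary conditional distribution
  set PUV : S → Fin (Fintype.card X * Fintype.card S + 2) × Fin 1 → ℝ := fun s t =>
    if ch.QS s = 0 then w t.1 else w t.1 * q t.1 s / ch.QS s with hPUV
  have hmem : ∀ s, PUV s ∈ stdSimplex ℝ _ := fun s => by
    refine ⟨fun t => ?_, ?_⟩
    · simp only [hPUV]
      split_ifs
      exacts [hw.1 _, div_nonneg (mul_nonneg (hw.1 _) ((hq _).1 _)) (ch.QS_mem.1 _)]
    · rw [Fintype.sum_prod_type]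
      simp only [hPUV, Finset.univ_unique, Finset.sum_singleton]
      split_ifs with h
      · exact hw.2
      · rw [← Finset.sum_div, hQ, div_self h]
  have haux : ∀ u, ch.auxInput PUV x u = w u • detInput (x u) (q u) := fun u => by
    ext ⟨s, a⟩
    have : ch.QS s * ∑ v, PUV s (u, v) = w u * q u s := by
      simp only [hPUV, Finset.univ_unique, Finset.sum_singleton]
      split_ifs with h
      · rw [h, zero_mul]
        have := hQ s
        rw [h, Finset.sum_eq_zero_iff_of_nonneg fun u _ => mul_nonneg (hw.1 u) ((hq u).1 s)] at this
        exact (this u (Finset.mem_univ u)).symm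
      · field_simp
    change ch.QS s * (∑ v, PUV s (u, v)) * (if a = x u s then 1 else 0) =
      w u * if a = x u s then q u s else 0
    rw [this]
    simp
  have hval : rateBound (ch.auxJoint PUV x) * Real.log 2 = ch.objective c := by
    rw [ch.rateBound_auxJoint_of_subsingleton hmem, ch.mutualInfo_sub_mutualInfo_auxJoint hmem]
    simp only [haux, gain_smul, hfst, hsnd]
    rfl
  refine ⟨_, ⟨⟨PUV, x, hmem, rfl⟩, ?_, ?_⟩, hval⟩
  · refine (ch.law_auxJoint_outZ PUV x).trans ?_
    simp only [haux, hfst, hZ]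
  · have hm := ch.auxJoint_mem_stdSimplex hmem x
    have h1 := mutualInfo_subsingleton_left hm (fun ω => ω.2.2.1) (fun ω => ω.2.2.2.2.2)
    have h2 := mutualInfo_subsingleton_left hm (fun ω => ω.2.2.1) (fun ω => ω.1)
    change mutualInfo (ch.auxJoint PUV x) (fun ω => ω.2.2.1) (fun ω => ω.2.2.2.2.2) -
      mutualInfo (ch.auxJoint PUV x) (fun ω => ω.2.2.1) (fun ω => ω.1) ≤ _
    rw [h1, h2, sub_self]
    rw [← hval] at h0
    exact nonneg_of_mul_nonneg_left h0 (Real.log_pos one_lt_two)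

lemma isGreatest_outerRegion (ch : StateChannel X S Y Z) {c : (S × X → ℝ) × ℝ}
    (hc : c ∈ ch.feasible) (h0 : 0 ≤ ch.objective c)
    (hmax : ∀ c' ∈ ch.feasible, ch.objective c' ≤ ch.objective c) :
    IsGreatest ch.outerRegion (ch.objective c / Real.log 2) := by
  have h2 : 0 < Real.log 2 := Real.log_pos one_lt_two
  constructor
  · obtain ⟨P, hP, hval⟩ := ch.exists_admissible_of_feasible hc h0
    exact ⟨div_nonneg h0 h2.le, _, _, max_le (Nat.le_succ _) (by omega), P, hP,
      by rw [div_le_iff₀ h2, hval]⟩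
  · rintro R ⟨-, k, l, -, P, hP, hR⟩
    obtain ⟨c', hc', h⟩ := ch.exists_feasible_of_admissible hP
    rw [le_div_iff₀ h2]
    exact (mul_le_mul_of_nonneg_right hR h2.le).trans (h.trans (hmax c' hc'))

end Region

end StateChannel

/-! ### The auxiliary variables of the converse -/

namespace StateChannel

section Converse

variable {X S Y Z : Type*} {n M : ℕ}

/-- The auxiliary variable at time `i`: the message, the legitimate outputs before time `i` and
the states after time `i`. -/
def auxVar (i : Fin n) (ω : Fin M × (Fin n → S) × (Fin n → X) × (Fin n → Y) × (Fin n → Z)) :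
    Fin M × (Fin n → Option (Y ⊕ S)) :=
  (ω.1, fun j => if j < i then some (Sum.inl (ω.2.2.2.1 j)) else
    if j = i then none else some (Sum.inr (ω.2.1 j)))

/-- The message, the first `k` legitimate outputs and the states from time `k` on. -/
def hybrid (k : ℕ) (ω : Fin M × (Fin n → S) × (Fin n → X) × (Fin n → Y) × (Fin n → Z)) :
    Fin M × (Fin n → Y ⊕ S) :=
  (ω.1, fun j => if (j : ℕ) < k then Sum.inl (ω.2.2.2.1 j) else Sum.inr (ω.2.1 j))

lemma auxVar_eq_iff (i : Fin n)
    (ω ω' : Fin M × (Fin n → S) × (Fin n → X) × (Fin n → Y) × (Fin n → Z)) :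
    auxVar i ω = auxVar i ω' ↔ ω.1 = ω'.1 ∧ (∀ j < i, ω.2.2.2.1 j = ω'.2.2.2.1 j) ∧
      ∀ j, i < j → ω.2.1 j = ω'.2.1 j := by
  simp only [auxVar, Prod.mk.injEq, funext_iff]
  refine and_congr_right fun _ => ⟨fun h => ⟨fun j hj => ?_, fun j hj => ?_⟩, fun h j => ?_⟩
  · simpa [hj] using h j
  · simpa [hj.not_gt, hj.ne'] using h j
  · rcases lt_trichotomy j i with hj | rfl | hj
    · simp [hj, h.1 j hj]
    · simp
    · simp [hj.not_gt, hj.ne', h.2 j hj]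

lemma hybrid_eq_iff (k : ℕ)
    (ω ω' : Fin M × (Fin n → S) × (Fin n → X) × (Fin n → Y) × (Fin n → Z)) :
    hybrid k ω = hybrid k ω' ↔ ω.1 = ω'.1 ∧
      (∀ j : Fin n, (j : ℕ) < k → ω.2.2.2.1 j = ω'.2.2.2.1 j) ∧
      ∀ j : Fin n, k ≤ j → ω.2.1 j = ω'.2.1 j := by
  simp only [hybrid, Prod.mk.injEq, funext_iff]
  refine and_congr_right fun _ => ⟨fun h => ⟨fun j hj => ?_, fun j hj => ?_⟩, fun h j => ?_⟩
  · simpa [hj] using h j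
  · simpa [hj.not_gt] using h j
  · rcases lt_or_ge (j : ℕ) k with hj | hj
    · simp [hj, h.1 j hj]
    · simp [hj.not_gt, h.2 j hj]

/-! ### The joint law of a code -/

variable [Fintype S] [Fintype Y] [Fintype Z]

lemma sum_prod_W (ch : StateChannel X S Y Z) (s : Fin n → S) (x : Fin n → X) :
    ∑ t : Fin n → Y × Z, ∏ i, ch.W (x i) (s i) (t i) = 1 := by
  rw [← Fintype.piFinset_univ, ← Finset.prod_univ_sum]
  exact Finset.prod_eq_one fun i _ => (ch.W_mem _ _).2

lemma sum_prod_QS (ch : StateChannel X S Y Z) :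
    ∑ s : Fin n → S, ∏ i, ch.QS (s i) = 1 := by
  rw [← Fintype.piFinset_univ, ← Finset.prod_univ_sum]
  exact Finset.prod_eq_one fun i _ => ch.QS_mem.2

variable [Fintype X]

lemma codeJoint_nonneg (ch : StateChannel X S Y Z) (c : Code X S Y n M)
    (ω : Fin M × (Fin n → S) × (Fin n → X) × (Fin n → Y) × (Fin n → Z)) :
    0 ≤ ch.codeJoint c ω := by
  obtain ⟨m, s, x, y, z⟩ := ω
  exact mul_nonneg (mul_nonneg (mul_nonneg (by positivity)
    (Finset.prod_nonneg fun i _ => ch.QS_mem.1 _)) ((c.enc_mem m s).1 x))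
    (Finset.prod_nonneg fun i _ => (ch.W_mem _ _).1 _)

/-- Expectations under the law of a code, with the output sequences paired letter by letter. -/
lemma sum_codeJoint_mul (ch : StateChannel X S Y Z) (c : Code X S Y n M)
    (φ : Fin M → (Fin n → S) → (Fin n → X) → (Fin n → Y) → (Fin n → Z) → ℝ) :
    ∑ ω, ch.codeJoint c ω * φ ω.1 ω.2.1 ω.2.2.1 ω.2.2.2.1 ω.2.2.2.2 =
      ∑ m, ∑ s, ∑ x, ((1 / (M : ℝ)) * (∏ i, ch.QS (s i)) * c.enc m s x) *
        ∑ t : Fin n → Y × Z, (∏ i, ch.W (x i) (s i) (t i)) *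
          φ m s x (fun i => (t i).1) (fun i => (t i).2) := by
  rw [Fintype.sum_prod_type]
  refine Finset.sum_congr rfl fun m _ => ?_
  rw [Fintype.sum_prod_type]
  refine Finset.sum_congr rfl fun s _ => ?_
  rw [Fintype.sum_prod_type]
  refine Finset.sum_congr rfl fun x _ => ?_
  rw [Finset.mul_sum,
    ← Equiv.sum_comp (Equiv.arrowProdEquivProdArrow (Fin n) (fun _ => Y) fun _ => Z)]
  exact Finset.sum_congr rfl fun t _ => mul_assoc _ _ _

/-- Given the other variables, the outputs at time `i` are produced from the input and the state
at time `i` by the channel. -/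
lemma sum_codeJoint_mul_output (ch : StateChannel X S Y Z) (c : Code X S Y n M) (i : Fin n)
    (φ : Fin M → (Fin n → S) → (Fin n → X) → (Fin n → Y) → ℝ)
    (hφ : ∀ m s x y y', (∀ j, j ≠ i → y j = y' j) → φ m s x y = φ m s x y')
    (ψ : Y × Z → ℝ) :
    ∑ ω, ch.codeJoint c ω *
        (φ ω.1 ω.2.1 ω.2.2.1 ω.2.2.2.1 * ψ (ω.2.2.2.1 i, ω.2.2.2.2 i)) =
      ∑ ω, ch.codeJoint c ω * (φ ω.1 ω.2.1 ω.2.2.1 ω.2.2.2.1 *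
        ∑ b, ch.W (ω.2.2.1 i) (ω.2.1 i) b * ψ b) := by
  rw [ch.sum_codeJoint_mul c fun m s x y z => φ m s x y * ψ (y i, z i),
    ch.sum_codeJoint_mul c fun m s x y z => φ m s x y * ∑ b, ch.W (x i) (s i) b * ψ b]
  refine Finset.sum_congr rfl fun m _ => Finset.sum_congr rfl fun s _ =>
    Finset.sum_congr rfl fun x _ => congrArg _ ?_
  refine (sum_prod_mul_mul_eq (fun j => ch.W (x j) (s j)) i (ch.W_mem _ _).2
    (fun t => φ m s x fun j => (t j).1) (fun t t' h => hφ _ _ _ _ _ fun j hj => by rw [h j hj])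
    ψ).trans ?_
  rw [Finset.mul_sum]
  exact Finset.sum_congr rfl fun t _ => by ring

lemma sum_codeJoint_mul_state (ch : StateChannel X S Y Z) (c : Code X S Y n M)
    (φ : Fin M → (Fin n → S) → ℝ) :
    ∑ ω, ch.codeJoint c ω * φ ω.1 ω.2.1 =
      ∑ m, ∑ s, ((1 / (M : ℝ)) * ∏ i, ch.QS (s i)) * φ m s := by
  rw [ch.sum_codeJoint_mul c fun m s _ _ _ => φ m s]
  refine Finset.sum_congr rfl fun m _ => Finset.sum_congr rfl fun s _ => ?_
  simp only [← Finset.sum_mul, sum_prod_W, ← Finset.mul_sum, (c.enc_mem m s).2, one_mul, mul_one]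

lemma codeJoint_mem_stdSimplex (ch : StateChannel X S Y Z) (hM : 0 < M) (c : Code X S Y n M) :
    ch.codeJoint c ∈
      stdSimplex ℝ (Fin M × (Fin n → S) × (Fin n → X) × (Fin n → Y) × (Fin n → Z)) := by
  refine ⟨ch.codeJoint_nonneg c, ?_⟩
  have h := ch.sum_codeJoint_mul_state c fun _ _ => 1
  simp only [mul_one, ← Finset.mul_sum, sum_prod_QS] at h
  rw [h]
  have hM' : (M : ℝ) ≠ 0 := by positivity
  simp [hM']

lemma law_codeJoint_message_state (ch : StateChannel X S Y Z) (c : Code X S Y n M)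
    (m : Fin M) (s : Fin n → S) :
    law (ch.codeJoint c) (fun ω => (ω.1, ω.2.1)) (m, s) = (1 / (M : ℝ)) * ∏ i, ch.QS (s i) := by
  classical
  rw [law_eq_sum_mul]
  refine (ch.sum_codeJoint_mul_state c fun m' s' => if (m', s') = (m, s) then 1 else 0).trans ?_
  rw [Finset.sum_eq_single m (fun m' _ h => by simp [h]) (by simp),
    Finset.sum_eq_single s (fun s' _ h => by simp [h]) (by simp)]
  simp

lemma law_codeJoint_state (ch : StateChannel X S Y Z) (hM : 0 < M) (c : Code X S Y n M)
    (i : Fin n) : law (ch.codeJoint c) (fun ω => ω.2.1 i) = ch.QS := by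
  classical
  ext a
  have hM' : (M : ℝ) ≠ 0 := by positivity
  rw [law_eq_sum_mul]
  refine (ch.sum_codeJoint_mul_state c fun _ s => if s i = a then 1 else 0).trans ?_
  have h := sum_prod_mul_mul_eq (fun _ : Fin n => ch.QS) i ch.QS_mem.2 (fun _ => 1)
    (fun _ _ _ => rfl) fun b => if b = a then 1 else 0
  simp only [one_mul, mul_one, sum_prod_QS] at h
  simp only [mul_assoc, ← Finset.mul_sum, h]
  simp [hM']

lemma ent_law_codeJoint_message_state (ch : StateChannel X S Y Z) (hM : 0 < M)
    (c : Code X S Y n M) :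
    ent (law (ch.codeJoint c) fun ω => (ω.1, ω.2.1)) = Real.log M + n * ent ch.QS := by
  have hmem := ch.codeJoint_mem_stdSimplex hM c
  have hM' : (M : ℝ) ≠ 0 := by positivity
  have h1 : ∀ i, ∑ ω, ch.codeJoint c ω * Real.log (ch.QS (ω.2.1 i)) = -ent ch.QS := fun i => by
    rw [← sum_law_mul (ch.codeJoint c) (fun ω => ω.2.1 i) fun a => Real.log (ch.QS a),
      ch.law_codeJoint_state hM c]
    simp [ent, Real.negMulLog]
  have h2 : ∀ ω, ch.codeJoint c ω * Real.log ((1 / (M : ℝ)) * ∏ i, ch.QS (ω.2.1 i)) =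
      ch.codeJoint c ω * -Real.log M + ∑ i, ch.codeJoint c ω * Real.log (ch.QS (ω.2.1 i)) := by
    intro ω
    by_cases hω : ch.codeJoint c ω = 0
    · simp [hω]
    have hQ : ∏ i, ch.QS (ω.2.1 i) ≠ 0 := fun h => hω (by
      obtain ⟨m, s, x, y, z⟩ := ω
      simp only at h
      simp [codeJoint, h])
    rw [Real.log_mul (one_div_ne_zero hM') hQ,
      Real.log_prod fun i hi => Finset.prod_ne_zero_iff.1 hQ i hi, one_div, Real.log_inv, mul_add,
      Finset.mul_sum]
  rw [ent_law]
  simp only [law_codeJoint_message_state, h2, Finset.sum_add_distrib, ← Finset.sum_mul, hmem.2]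
  rw [Finset.sum_comm]
  simp only [h1]
  simp [add_comm]

/-! ### The converse -/

lemma ent_law_auxVar_state (P : Fin M × (Fin n → S) × (Fin n → X) × (Fin n → Y) × (Fin n → Z) → ℝ)
    (i : Fin n) :
    ent (law P fun ω => (auxVar i ω, ω.2.1 i)) = ent (law P (hybrid (i : ℕ))) := by
  refine ent_law_congr P fun ω ω' => ?_
  rw [Prod.mk.injEq, auxVar_eq_iff, hybrid_eq_iff]
  constructor
  · rintro ⟨⟨h1, h2, h3⟩, h4⟩
    refine ⟨h1, fun j hj => h2 j hj, fun j hj => ?_⟩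
    rcases (Fin.le_def.2 hj : i ≤ j).eq_or_lt with rfl | hj
    exacts [h4, h3 j hj]
  · rintro ⟨h1, h2, h3⟩
    exact ⟨⟨h1, fun j hj => h2 j hj, fun j hj => h3 j (Fin.lt_def.1 hj).le⟩, h3 i le_rfl⟩

lemma ent_law_auxVar_output
    (P : Fin M × (Fin n → S) × (Fin n → X) × (Fin n → Y) × (Fin n → Z) → ℝ) (i : Fin n) :
    ent (law P fun ω => (auxVar i ω, ω.2.2.2.1 i)) = ent (law P (hybrid ((i : ℕ) + 1))) := by
  refine ent_law_congr P fun ω ω' => ?_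
  rw [Prod.mk.injEq, auxVar_eq_iff, hybrid_eq_iff]
  constructor
  · rintro ⟨⟨h1, h2, h3⟩, h4⟩
    refine ⟨h1, fun j hj => ?_, fun j hj => h3 j (Fin.lt_def.2 hj)⟩
    rcases (Fin.le_def.2 (Nat.lt_succ_iff.1 hj) : j ≤ i).eq_or_lt with rfl | hj
    exacts [h4, h2 j hj]
  · rintro ⟨h1, h2, h3⟩
    exact ⟨⟨h1, fun j hj => h2 j (Nat.lt_succ_of_lt (Fin.lt_def.1 hj)), fun j hj =>
      h3 j (Fin.lt_def.1 hj)⟩, h2 i (Nat.lt_succ_self _)⟩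

/-- Telescoping along the hybrids; this takes the place of Csiszár's sum identity. -/
lemma sum_ent_auxVar (P : Fin M × (Fin n → S) × (Fin n → X) × (Fin n → Y) × (Fin n → Z) → ℝ) :
    ∑ i, (ent (law P fun ω => (auxVar i ω, ω.2.1 i)) -
        ent (law P fun ω => (auxVar i ω, ω.2.2.2.1 i))) =
      ent (law P fun ω => (ω.1, ω.2.1)) - ent (law P fun ω => (ω.1, ω.2.2.2.1)) := by
  simp only [ent_law_auxVar_state, ent_law_auxVar_output]
  rw [Fin.sum_univ_eq_sum_range fun k => ent (law P (hybrid k)) - ent (law P (hybrid (k + 1))),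
    Finset.sum_range_sub',
    ent_law_congr P (f := hybrid 0) (g := fun ω => (ω.1, ω.2.1)) fun ω ω' => by
      rw [hybrid_eq_iff]; simp [Prod.ext_iff, funext_iff],
    ent_law_congr P (f := hybrid n) (g := fun ω => (ω.1, ω.2.2.2.1)) fun ω ω' => by
      rw [hybrid_eq_iff]; simp [Prod.ext_iff, funext_iff]]

/-- The law of the state and the input at time `i`, restricted to the value `u` of the auxiliary
variable. -/
noncomputable def codeInput (ch : StateChannel X S Y Z) (c : Code X S Y n M) (i : Fin n)
    (u : Fin M × (Fin n → Option (Y ⊕ S))) : S × X → ℝ :=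
  fun p => law (ch.codeJoint c) (fun ω => (auxVar i ω, (ω.2.1 i, ω.2.2.1 i))) (u, p)

lemma stateMarg_codeInput (ch : StateChannel X S Y Z) (c : Code X S Y n M) (i : Fin n)
    (u : Fin M × (Fin n → Option (Y ⊕ S))) (s : S) :
    stateMarg (ch.codeInput c i u) s =
      law (ch.codeJoint c) (fun ω => (auxVar i ω, ω.2.1 i)) (u, s) := by
  rw [← sum_law_pair_right _ _ fun ω => ω.2.2.1 i]
  exact Finset.sum_congr rfl fun x _ => law_congr_of_iff _ fun ω => by simp [and_assoc]

lemma outY_codeInput (ch : StateChannel X S Y Z) (c : Code X S Y n M) (i : Fin n)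
    (u : Fin M × (Fin n → Option (Y ⊕ S))) (y : Y) :
    ch.outY (ch.codeInput c i u) y =
      law (ch.codeJoint c) (fun ω => (auxVar i ω, ω.2.2.2.1 i)) (u, y) := by
  classical
  have h := ch.sum_codeJoint_mul_output c i
    (fun m s x y => if (m, fun j => if j < i then some (Sum.inl (y j)) else
      if j = i then none else some (Sum.inr (s j))) = u then 1 else 0)
    (fun m s x y y' hy => by
      have : (fun j => if j < i then some (Sum.inl (y j)) else
          if j = i then none else some (Sum.inr (s j))) =
          fun j => if j < i then some (Sum.inl (y' j)) else
          if j = i then none else some (Sum.inr (s j)) := by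
        funext j
        by_cases hj : j < i
        · simp [hj, hy j hj.ne]
        · simp [hj]
      rw [this])
    (fun b => if b.1 = y then 1 else 0)
  have hW : ∀ x s, ∑ b : Y × Z, ch.W x s b * (if b.1 = y then 1 else 0) = ch.WY x s y := by
    intro x s
    rw [Fintype.sum_prod_type, Finset.sum_eq_single y (fun y' _ h => by simp [h]) (by simp)]
    simp [WY]
  simp only [hW] at h
  rw [law_eq_sum_mul]
  refine (sum_law_pair_mul (ch.codeJoint c) (auxVar i) (fun ω => (ω.2.1 i, ω.2.2.1 i)) u
    fun p => ch.WY p.2 p.1 y).trans (h.symm.trans ?_)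
  refine Finset.sum_congr rfl fun ω _ => ?_
  simp only [Prod.mk.injEq, ite_and, mul_ite, mul_one, mul_zero, auxVar]
  split_ifs <;> rfl

lemma outZ_sum_codeInput (ch : StateChannel X S Y Z) (c : Code X S Y n M) (i : Fin n) :
    ch.outZ (∑ u, ch.codeInput c i u) = law (ch.codeJoint c) fun ω => ω.2.2.2.2 i := by
  classical
  ext z
  have h1 : ∑ u, ch.codeInput c i u =
      law (ch.codeJoint c) fun ω => (ω.2.1 i, ω.2.2.1 i) := by
    ext p
    rw [Finset.sum_apply]
    exact sum_law_pair_left _ _ _ p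
  have h := ch.sum_codeJoint_mul_output c i (fun _ _ _ _ => 1) (fun _ _ _ _ _ _ => rfl)
    (fun b => if b.2 = z then 1 else 0)
  have hW : ∀ x s, ∑ b : Y × Z, ch.W x s b * (if b.2 = z then 1 else 0) = ch.WZ x s z := by
    intro x s
    rw [Fintype.sum_prod_type]
    simp [WZ]
  simp only [hW, one_mul] at h
  rw [h1, law_eq_sum_mul, h]
  exact sum_law_mul (ch.codeJoint c) (fun ω => (ω.2.1 i, ω.2.2.1 i)) fun p => ch.WZ p.2 p.1 z

/-- The converse at blocklength `n`: the time-shared laws of state, input and auxiliary variable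
of a code give a point of the hull with the correct state law. -/
lemma exists_mem_convexHull_of_code (ch : StateChannel X S Y Z) (hn : 0 < n) (hM : 0 < M)
    (c : Code X S Y n M) :
    ∃ d ∈ convexHull ℝ ch.strategyGraph, stateMarg d.1 = ch.QS ∧
      ch.outZ d.1 = avgLaw (ch.codeJoint c) (fun ω => ω.2.2.2.2) ∧
      Real.log M ≤ n * ch.objective d + Real.log 2 + ch.errorProb c * Real.log M := by
  have hn' : (n : ℝ) ≠ 0 := by positivity
  have hP := ch.codeJoint_mem_stdSimplex hM c
  set P := ch.codeJoint c with hPdef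
  let μ : Fin n × (Fin M × (Fin n → Option (Y ⊕ S))) → S × X → ℝ :=
    fun j => (n : ℝ)⁻¹ • ch.codeInput c j.1 j.2
  have hsum : ∑ j, μ j = (n : ℝ)⁻¹ • ∑ i, ∑ u, ch.codeInput c i u := by
    simp only [μ, ← Finset.smul_sum, Fintype.sum_prod_type]
  have hS : stateMarg (∑ j, μ j) = ch.QS := by
    have : ∀ i, stateMarg (∑ u, ch.codeInput c i u) = ch.QS := fun i => by
      ext s
      rw [map_sum, Finset.sum_apply]
      simp only [stateMarg_codeInput]
      rw [sum_law_pair_left, ch.law_codeJoint_state hM]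
    rw [hsum, map_smul, map_sum]
    simp only [this]
    ext s
    simp [hn']
  have hZ : ch.outZ (∑ j, μ j) = avgLaw P fun ω => ω.2.2.2.2 := by
    rw [hsum, map_smul, map_sum]
    simp only [outZ_sum_codeInput]
    ext z
    simp [avgLaw, div_eq_inv_mul, hPdef]
  have hY : ch.outY (∑ j, μ j) = avgLaw P fun ω => ω.2.2.2.1 := by
    rw [hsum, map_smul, map_sum]
    ext y
    simp only [Pi.smul_apply, Finset.sum_apply, map_sum, outY_codeInput, sum_law_pair_left]
    simp [avgLaw, div_eq_inv_mul, hPdef]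
  have hμ0 : ∀ j p, 0 ≤ μ j p := fun j p =>
    mul_nonneg (by positivity) (law_nonneg hP.1 _ _)
  have hμ1 : ∑ j, ∑ p, μ j p = 1 := by
    have := sum_stateMarg (∑ j, μ j)
    rw [hS, ch.QS_mem.2] at this
    rw [this, Finset.sum_comm]
    simp only [Finset.sum_apply]
  obtain ⟨d, hd, hd1, hd2⟩ := ch.exists_mem_convexHull_of_sum hμ0 hμ1
  refine ⟨d, hd, by rw [hd1, hS], by rw [hd1, hZ], ?_⟩
  have hgain : n * ∑ j, ch.gain (μ j) =
      Real.log M + n * ent ch.QS - ent (law P fun ω => (ω.1, ω.2.2.2.1)) := by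
    rw [← ch.ent_law_codeJoint_message_state hM c, ← sum_ent_auxVar]
    simp only [μ, gain_smul, ← Finset.mul_sum, mul_inv_cancel_left₀ hn', Fintype.sum_prod_type]
    refine Finset.sum_congr rfl fun i _ => ?_
    simp only [gain, Finset.sum_sub_distrib, ent, stateMarg_codeInput, outY_codeInput,
      Fintype.sum_prod_type]
  have hgain' : ch.gain (∑ j, μ j) = ent ch.QS - ent (avgLaw P fun ω => ω.2.2.2.1) := by
    rw [gain, hS, hY]
  have hobj := mul_le_mul_of_nonneg_left hd2 (by positivity : (0 : ℝ) ≤ n)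
  rw [mul_sub, hgain, hgain', mul_sub] at hobj
  have hsub := ent_law_le_mul_ent_avgLaw hn hP fun ω => ω.2.2.2.1
  have hfano := ent_law_pair_sub_le hP (fun ω => ω.1) (fun ω => ω.2.2.2.1) c.dec
  change _ ≤ _ + ch.errorProb c * _ at hfano
  linarith

/-! ### Passage to the limit -/

/-- The converse: along a subsequence of blocklengths the points of the hull obtained from the codes
converge, and the limit is feasible because its warden law has zero divergence from `Q₀`. -/
lemma objective_ge_of_isAchievable (ch : StateChannel X S Y Z) (hQ₀ : ∀ z, 0 < ch.Q₀ z) {R : ℝ}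
    (hR : ch.IsAchievable R) : ∃ d ∈ ch.feasible, R * Real.log 2 ≤ ch.objective d := by
  obtain ⟨M, c, hM, hrate, herr, hkl⟩ := hR
  have h2 : Real.log 2 ≠ 0 := (Real.log_pos one_lt_two).ne'
  -- blocklength zero is skipped: there is no time index to average over
  choose d hd hdS hdZ hdR using fun n : ℕ =>
    ch.exists_mem_convexHull_of_code n.succ_pos (hM (n + 1)) (c (n + 1))
  obtain ⟨a, ha, φ, hφ, hlim⟩ := ch.isCompact_convexHull_strategyGraph.tendsto_subseq hd
  have hφ1 : Tendsto (fun k => φ k + 1) atTop atTop :=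
    (tendsto_add_atTop_nat 1).comp hφ.tendsto_atTop
  have hcS : Continuous fun e : (S × X → ℝ) × ℝ => stateMarg e.1 :=
    (LinearMap.continuous_of_finiteDimensional stateMarg).comp continuous_fst
  have hcZ : Continuous fun e : (S × X → ℝ) × ℝ => ch.outZ e.1 :=
    (LinearMap.continuous_of_finiteDimensional ch.outZ).comp continuous_fst
  have haS : stateMarg a.1 = ch.QS := by
    have := (hcS.tendsto a).comp hlim
    refine tendsto_nhds_unique this (tendsto_const_nhds.congr fun k => (hdS (φ k)).symm)
  have hQsum : ∑ z, ch.Q₀ z = 1 := by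
    simp only [Q₀]
    rw [Finset.sum_comm]
    simp only [← Finset.mul_sum]
    rw [← ch.QS_mem.2]
    refine Finset.sum_congr rfl fun s _ => ?_
    rw [Finset.sum_comm, ← Fintype.sum_prod_type (f := ch.W ch.x₀ s), (ch.W_mem _ _).2, mul_one]
  have havg : ∀ n, ch.outZ (d n).1 ∈ stdSimplex ℝ Z := fun n => by
    rw [hdZ]
    exact avgLaw_mem_stdSimplex n.succ_pos (ch.codeJoint_mem_stdSimplex (hM _) _) _
  have hZlim : Tendsto (fun k => ch.outZ (d (φ k)).1) atTop (𝓝 (ch.outZ a.1)) :=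
    (hcZ.tendsto a).comp hlim
  have haZmem : ch.outZ a.1 ∈ stdSimplex ℝ Z :=
    (isCompact_stdSimplex ℝ Z).isClosed.mem_of_tendsto hZlim
      (Eventually.of_forall fun k => havg _)
  -- the zeros of `p z` are harmless, as `x * log x` is continuous on the whole line
  have hklc : Continuous fun p : Z → ℝ => kl p ch.Q₀ := by
    have : (fun p : Z → ℝ => kl p ch.Q₀) = fun p =>
        ∑ z, ch.Q₀ z * (p z / ch.Q₀ z * Real.log (p z / ch.Q₀ z)) / Real.log 2 := by
      funext p
      refine Finset.sum_congr rfl fun z _ => ?_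
      have := (hQ₀ z).ne'
      rw [Real.logb]
      field_simp
    rw [this]
    refine continuous_finsetSum _ fun z _ => (continuous_const.mul ?_).div_const _
    exact Real.continuous_mul_log.comp ((continuous_apply z).div_const _)
  have hklle : kl (ch.outZ a.1) ch.Q₀ ≤ 0 := by
    refine le_of_tendsto_of_tendsto ((hklc.tendsto _).comp hZlim) (hkl.comp hφ1)
      (Eventually.of_forall fun k => ?_)
    have h := mul_kl_avgLaw_le (φ k).succ_pos
      (ch.codeJoint_mem_stdSimplex (hM (φ k + 1)) (c (φ k + 1))) (fun ω => ω.2.2.2.2) hQ₀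
    rw [← hdZ] at h
    refine le_trans ?_ h
    have h0 := kl_nonneg (havg (φ k)).1 hQ₀ ((havg (φ k)).2.trans hQsum.symm)
    refine le_mul_of_one_le_left h0 ?_
    exact_mod_cast (φ k).succ_pos
  have haZ : ch.outZ a.1 = ch.Q₀ :=
    eq_of_kl_eq_zero haZmem.1 hQ₀ (haZmem.2.trans hQsum.symm)
      (le_antisymm hklle (kl_nonneg haZmem.1 hQ₀ (haZmem.2.trans hQsum.symm)))
  refine ⟨a, ⟨ha, haS, haZ⟩, ?_⟩
  -- the converse at each blocklength, divided by the blocklength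
  have hbound : ∀ n : ℕ, (1 - ch.errorProb (c (n + 1))) *
      (Real.logb 2 (M (n + 1)) / (n + 1 : ℕ) * Real.log 2) ≤
        ch.objective (d n) + Real.log 2 / (n + 1 : ℕ) := by
    intro n
    have hn : (0 : ℝ) < (n + 1 : ℕ) := by positivity
    refine le_of_mul_le_mul_left ?_ hn
    have e : Real.logb 2 (M (n + 1)) * Real.log 2 = Real.log (M (n + 1)) := by
      rw [Real.logb, div_mul_cancel₀ _ h2]
    have e1 : ((n + 1 : ℕ) : ℝ) * ((1 - ch.errorProb (c (n + 1))) *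
        (Real.logb 2 (M (n + 1)) / (n + 1 : ℕ) * Real.log 2)) =
        (1 - ch.errorProb (c (n + 1))) * Real.log (M (n + 1)) := by
      rw [← e]
      field_simp
    rw [e1, mul_add, mul_div_cancel₀ _ hn.ne']
    have := hdR n
    linarith
  have hl : Tendsto (fun k => (1 - ch.errorProb (c (φ k + 1))) *
      (Real.logb 2 (M (φ k + 1)) / (φ k + 1 : ℕ) * Real.log 2)) atTop
      (𝓝 ((1 - 0) * (R * Real.log 2))) :=
    (tendsto_const_nhds.sub (herr.comp hφ1)).mul ((hrate.comp hφ1).mul_const _)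
  have hr : Tendsto (fun k => ch.objective (d (φ k)) + Real.log 2 / (φ k + 1 : ℕ)) atTop
      (𝓝 (ch.objective a + 0)) :=
    ((ch.continuous_objective.tendsto a).comp hlim).add
      ((tendsto_const_div_atTop_nhds_zero_nat (Real.log 2)).comp hφ1)
  simpa using le_of_tendsto_of_tendsto hl hr (Eventually.of_forall fun k => hbound (φ k))

/-- Sending the innocent symbol throughout is perfectly covert. -/
lemma isAchievable_zero (ch : StateChannel X S Y Z) (hQ₀ : ∀ z, 0 < ch.Q₀ z) :
    ch.IsAchievable 0 := by
  classical
  let c : ∀ n, Code X S Y n 1 := fun n =>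
    { enc := fun _ _ => Pi.single (fun _ => ch.x₀) 1
      enc_mem := fun _ _ => single_mem_stdSimplex ℝ _
      dec := fun _ => 0 }
  refine ⟨fun _ => 1, c, fun _ => one_pos, by simp, ?_, ?_⟩
  · have : ∀ n, ch.errorProb (c n) = 0 := fun n =>
      Finset.sum_eq_zero fun ω _ => if_neg (not_not.2 (Subsingleton.elim _ _))
    simp [this]
  · have hlaw : ∀ n, ch.wardenLaw (c n) = fun z => ∏ i, ch.Q₀ (z i) := by
      intro n
      ext z
      rw [wardenLaw, law_eq_sum_mul]
      refine (ch.sum_codeJoint_mul (c n)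
        fun _ _ _ _ z' => if z' = z then 1 else 0).trans ?_
      simp only [Finset.univ_unique, Finset.sum_singleton]
      have hinner : ∀ s : Fin n → S, ∑ t : Fin n → Y × Z,
          (∏ i, ch.W ch.x₀ (s i) (t i)) * (if (fun i => (t i).2) = z then 1 else 0) =
          ∏ i, ch.WZ ch.x₀ (s i) (z i) := by
        intro s
        have : ∀ t : Fin n → Y × Z,
            (∏ i, ch.W ch.x₀ (s i) (t i)) * (if (fun i => (t i).2) = z then 1 else 0) =
            ∏ i, ch.W ch.x₀ (s i) (t i) * (if (t i).2 = z i then 1 else 0) := by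
          intro t
          rw [Finset.prod_mul_distrib, Finset.prod_ite_zero]
          simp [funext_iff]
        simp only [this]
        rw [← Fintype.piFinset_univ, ← Finset.prod_univ_sum (fun _ : Fin n => Finset.univ)
          fun i b => ch.W ch.x₀ (s i) b * if b.2 = z i then 1 else 0]
        refine Finset.prod_congr rfl fun i _ => ?_
        rw [Fintype.sum_prod_type]
        simp [WZ]
      have hx : ∀ s : Fin n → S, ∑ x, (1 / ((1 : ℕ) : ℝ) * (∏ i, ch.QS (s i)) *
          (c n).enc default s x) * ∑ t : Fin n → Y × Z,
            (∏ i, ch.W (x i) (s i) (t i)) * (if (fun i => (t i).2) = z then 1 else 0) =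
          ∏ i, ch.QS (s i) * ch.WZ ch.x₀ (s i) (z i) := by
        intro s
        rw [Finset.sum_eq_single (fun _ => ch.x₀) (fun x _ h => by simp [c, h]) (by simp),
          hinner, Finset.prod_mul_distrib]
        simp [c]
      simp only [hx]
      rw [← Fintype.piFinset_univ, ← Finset.prod_univ_sum (fun _ : Fin n => Finset.univ)
        fun i a => ch.QS a * ch.WZ ch.x₀ a (z i)]
      rfl
    have : ∀ n, kl (ch.wardenLaw (c n)) (fun z => ∏ i, ch.Q₀ (z i)) = 0 := fun n => by
      rw [hlaw]
      refine Finset.sum_eq_zero fun z _ => ?_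
      rw [div_self (Finset.prod_pos fun i _ => hQ₀ _).ne']
      simp
    simp [this]

end Converse

end StateChannel

theorem mainTheorem5 {X S Y Z : Type*} [Fintype X] [Fintype S] [Fintype Y] [Fintype Z]
    (ch : StateChannel X S Y Z) (hQ₀ : ∀ z, 0 < ch.Q₀ z) :
    IsLUB {R | ch.IsAchievable R} ch.covertCapacity ∧
      ∃ m, IsGreatest ch.outerRegion m ∧ ch.covertCapacity ≤ m := by
  have h2 : 0 < Real.log 2 := Real.log_pos one_lt_two
  obtain ⟨d₀, hd₀, h0⟩ := ch.objective_ge_of_isAchievable hQ₀ (ch.isAchievable_zero hQ₀)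
  obtain ⟨d, hd, hmax⟩ := ch.isCompact_feasible.exists_isMaxOn ⟨d₀, hd₀⟩
    ch.continuous_objective.continuousOn
  rw [zero_mul] at h0
  have hub : ch.objective d / Real.log 2 ∈ upperBounds {R | ch.IsAchievable R} := by
    intro R hR
    obtain ⟨e, he, hle⟩ := ch.objective_ge_of_isAchievable hQ₀ hR
    rw [le_div_iff₀ h2]
    exact hle.trans (hmax he)
  have hlub : IsLUB {R | ch.IsAchievable R} ch.covertCapacity :=
    isLUB_csSup ⟨0, ch.isAchievable_zero hQ₀⟩ ⟨_, hub⟩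
  exact ⟨hlub, _, ch.isGreatest_outerRegion hd (h0.trans (hmax hd₀)) hmax, hlub.2 hub⟩
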